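/- Let $K$ be a quartic CM-field, i.e. a totally imaginary quadratic extension of a real quadratic field $K_0$, and write $\overline{\,\cdot\,}$ for complex conjugation on $K$. Assume that $K$ is not biquadratic (i.e. $K/\mathbb{Q}$ is not Galois with group the Klein four-group) and that $K\not\cong\mathbb{Q}(\zeta_5)$. Let $\mathcal{O}_K$ be the maximal order of $K$, let $\mathcal{O}'$ be an order of $K$ that is stable under complex conjugation, and put $f=[\mathcal{O}_K:\mathcal{O}']$. Let $\Phi$ be a CM-type of $K$ with values in $\mathbb{C}$, that is, a set of representatives of the embeddings $K\to\mathbb{C}$ up to complex conjugation. Let $K^r\subset\mathbb{C}$ be its reflex field, generated over $\mathbb{Q}$ by the numbers $\prod_{\phi\in\Phi}\phi(x)$ with $x\in K$. Let $K^c$ be the normal closure of $K$ over $\mathbb{Q}$, and let $\Phi^r=\{\psi^{-1}|_{K^r}\}$ be the set of embeddings $K^r\to K^c$ obtained from the embeddings $\psi:K^c\to\mathbb{C}$ that extend an element of $\Phi$. For a fractional ideal $\mathfrak{b}$ of $K^r$, let $N_{\Phi^r}(\mathfrak{b})$ be the ideal of $K$ with $N_{\Phi^r}(\mathfrak{b})\mathcal{O}_{K^c}=\prod_{\tau\in\Phi^r}\tau(\mathfrak{b})\mathcal{O}_{K^c}$.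 For an order $\mathcal{O}\supset\mathcal{O}'$ of $K$ stable under complex conjugation, let $I_{\mathcal{O}}$ be the group, under componentwise multiplication, of pairs $(\mathfrak{a},\alpha)$ where $\mathfrak{a}$ is an invertible fractional ideal of $\mathcal{O}$ coprime to $f$ and $\alpha\in K_0$ is totally positive with $\mathfrak{a}\overline{\mathfrak{a}}=\alpha\mathcal{O}$. Let $P_{\mathcal{O}}\subset I_{\mathcal{O}}$ be the subgroup of pairs of the form $(x\mathcal{O},x\overline{x})$ with $x\in K^\times$, and let $\mathfrak{C}(\mathcal{O})=I_{\mathcal{O}}/P_{\mathcal{O}}$. Let $I_{K^r}(f)$ be the group of fractional ideals of $\mathcal{O}_{K^r}$ coprime to $f$, and let $S_{\mathcal{O}}$ be the kernel of the homomorphism $$I_{K^r}(f)\to\mathfrak{C}(\mathcal{O}),\qquad \mathfrak{b}\mapsto(N_{\Phi^r}(\mathfrak{b}),N_{K^r/\mathbb{Q}}(\mathfrak{b})),$$ where $N_{\Phi^r}(\mathfrak{b})$ is read as a fractional ideal of $\mathcal{O}$ through the bijection $\mathfrak{a}\mapsto\mathfrak{a}\mathcal{O}_K$ between the invertible fractional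 ideals of $\mathcal{O}$ coprime to $f$ and those of $\mathcal{O}_K$. If $S_{\mathcal{O}_K}\subset S_{\mathcal{O}'}$, then $$[\mathcal{O}_K:\mathcal{O}']^2 \mid 2^{40}\cdot 3^{16}\cdot N_{K_0/\mathbb{Q}}(\Delta_{K/K_0}),$$ where $\Delta_{K/K_0}$ is the relative discriminant ideal of $K/K_0$. -/

import Mathlib

open NumberField
open scoped nonZeroDivisors

noncomputable section

namespace CMIndex

section General

/-- Let `ι : A → B` be a homomorphism of commutative rings carrying the subring (image of) `R` of
`A` into the subring (image of) `S` of `B`. The extension `𝔞 ↦ ι(𝔞)S` of (fractional) ideals is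
multiplicative. -/
def extend {R S A B : Type*} [CommRing R] [CommRing S] [CommRing A] [CommRing B] [Algebra R A]
    [Algebra S B] (ι : A →+* B)
    (h : ∀ r : R, ∃ s : S, algebraMap S B s = ι (algebraMap R A r)) :
    Submodule R A →* Submodule S B where
  toFun 𝔞 := Submodule.span S (ι '' (𝔞 : Set A))
  map_one' := by
    apply le_antisymm
    · rw [Submodule.span_le]
      rintro _ ⟨x, hx, rfl⟩
      obtain ⟨r, rfl⟩ := Submodule.mem_one.1 hx
      exact Submodule.mem_one.2 (h r)
    · rw [Submodule.one_eq_span, Submodule.span_le, Set.singleton_subset_iff]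
      exact Submodule.subset_span ⟨1, Submodule.one_le.1 le_rfl, map_one ι⟩
  map_mul' 𝔞 𝔟 := by
    rw [Submodule.span_mul_span]
    apply le_antisymm
    · rw [Submodule.span_le]
      rintro _ ⟨x, hx, rfl⟩
      refine Submodule.mul_induction_on hx (fun a ha b hb => ?_) (fun a b ha hb => ?_)
      · rw [map_mul]
        exact Submodule.subset_span
          (Set.mul_mem_mul (Set.mem_image_of_mem _ ha) (Set.mem_image_of_mem _ hb))
      · rw [map_add]
        exact add_mem ha hb
    · rw [Submodule.span_le]
      rintro _ ⟨_, ⟨a, ha, rfl⟩, _, ⟨b, hb, rfl⟩, rfl⟩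
      exact Submodule.subset_span ⟨a * b, Submodule.mul_mem_mul ha hb, map_mul ι a b⟩

/-- The group of invertible fractional `R`-ideals of `A` that are coprime to the integer `f`,
i.e. the quotients of invertible integral ideals `𝔟 ⊆ R` with `𝔟 + fR = R`. (The invertible
elements of the monoid of `R`-submodules of `A` are precisely the invertible fractional ideals.) -/
def coprimeIdeals (R A : Type*) [CommRing R] [CommRing A] [Algebra R A] (f : ℕ) :
    Subgroup (Submodule R A)ˣ :=
  Subgroup.closure {𝔟 | (𝔟 : Submodule R A) ≤ 1 ∧
    (𝔟 : Submodule R A) ⊔ Submodule.span R {(f : A)} = 1}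

/-- The principal ideal `xR` generated by a unit `x` of `A`. -/
def principal (R : Type*) {A : Type*} [CommRing R] [CommRing A] [Algebra R A] :
    Aˣ →* (Submodule R A)ˣ :=
  Units.map (Submodule.spanSingleton R).toMonoidHom

/-- `K` is a biquadratic number field: Galois over `ℚ` with group the Klein four-group. -/
def IsBiquadratic (K : Type*) [Field K] [NumberField K] : Prop :=
  IsGalois ℚ K ∧ IsKleinFour (K ≃ₐ[ℚ] K)

/-- The relative discriminant ideal `Δ_{L/F}`, the relative norm of the different. -/
def relDiscr (F L : Type*) [Field F] [NumberField F] [Field L] [NumberField L] [Algebra F L] :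
    Ideal (𝓞 F) :=
  Ideal.relNorm (𝓞 F) (differentIdeal (𝓞 F) (𝓞 L))

end General

section Orders

variable (K : Type*) [Field K] [NumberField K] [IsCMField K]

/-- An order of the CM-field `K` that is stable under complex conjugation. -/
structure CMOrder where
  /-- the underlying subring -/
  carrier : Subalgebra ℤ K
  fg : (Subalgebra.toSubmodule carrier).FG
  span_eq_top : Submodule.span ℚ (carrier : Set K) = ⊤
  conj_mem : ∀ x ∈ carrier, IsCMField.complexConj K x ∈ carrier

/-- The maximal order `𝓞 K`. -/
def maximalOrder : CMOrder K where
  carrier := integralClosure ℤ K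
  fg := Module.Finite.iff_fg.1 (inferInstanceAs (Module.Finite ℤ (𝓞 K)))
  span_eq_top := by
    rw [eq_top_iff]
    intro x _
    obtain ⟨a, b, hb, rfl⟩ := IsFractionRing.div_surjective (A := 𝓞 K) x
    obtain ⟨y, n, hn, h⟩ : ∃ (y : 𝓞 K) (n : ℤ), n ≠ 0 ∧
        algebraMap (𝓞 K) K a / algebraMap (𝓞 K) K b * (n : K) = algebraMap (𝓞 K) K y := by
      obtain ⟨⟨y, n⟩, h⟩ := IsLocalization.surj (Algebra.algebraMapSubmonoid (𝓞 K) ℤ⁰)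
        (algebraMap (𝓞 K) K a / algebraMap (𝓞 K) K b)
      obtain ⟨m, hm, hmn⟩ := n.2
      exact ⟨y, m, nonZeroDivisors.ne_zero hm, by simpa [← hmn] using h⟩
    have hx : algebraMap (𝓞 K) K a / algebraMap (𝓞 K) K b = (n : ℚ)⁻¹ • (y : K) := by
      have hnK : (n : K) ≠ 0 := by exact_mod_cast hn
      rw [Algebra.smul_def, map_inv₀, map_intCast, eq_inv_mul_iff_mul_eq₀ hnK, mul_comm]
      exact h
    rw [hx]
    exact Submodule.smul_mem _ _ (Submodule.subset_span y.2)
  conj_mem x hx := IsIntegral.map (IsCMField.complexConj K) hx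

variable {K}

/-- The index `[𝓞 K : O]`. -/
def CMOrder.index (O : CMOrder K) : ℕ :=
  (Subalgebra.toSubmodule O.carrier).toAddSubgroup.relIndex
    (Subalgebra.toSubmodule (maximalOrder K).carrier).toAddSubgroup

/-- Complex conjugation `𝔞 ↦ 𝔞̄` on the invertible fractional ideals of `O`. -/
def CMOrder.conjIdeal (O : CMOrder K) : (Submodule O.carrier K)ˣ →* (Submodule O.carrier K)ˣ :=
  Units.map (extend (R := O.carrier) (S := O.carrier)
    (IsCMField.complexConj K : K ≃ₐ[maximalRealSubfield K] K).toRingEquiv.toRingHom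
    (fun r => ⟨⟨_, O.conj_mem r.1 r.2⟩, rfl⟩))

/-- The group `I_O` of pairs `(𝔞, α)` with `𝔞` an invertible fractional ideal of `O` coprime to
`f`, and `α ∈ K₀` totally positive with `𝔞𝔞̄ = αO`. -/
def CMOrder.polarisedIdeals (O : CMOrder K) (f : ℕ) :
    Subgroup ((Submodule O.carrier K)ˣ × (maximalRealSubfield K)ˣ) where
  carrier := {p | p.1 ∈ coprimeIdeals O.carrier K f ∧
    p.1 * O.conjIdeal p.1 =
      principal O.carrier (Units.map (algebraMap (maximalRealSubfield K) K).toMonoidHom p.2) ∧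
    ∀ φ : maximalRealSubfield K →+* ℝ, 0 < φ p.2}
  one_mem' := ⟨one_mem _, by simp, fun φ => by simp⟩
  mul_mem' := by
    rintro p q ⟨hp, hp', hp''⟩ ⟨hq, hq', hq''⟩
    refine ⟨mul_mem hp hq, ?_, fun φ => ?_⟩
    · simp only [Prod.fst_mul, Prod.snd_mul, map_mul] at *
      rw [← hp', ← hq', mul_mul_mul_comm]
    · simpa using mul_pos (hp'' φ) (hq'' φ)
  inv_mem' := by
    rintro p ⟨hp, hp', hp''⟩
    refine ⟨inv_mem hp, ?_, fun φ => ?_⟩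
    · simp only [Prod.fst_inv, Prod.snd_inv, map_inv] at *
      rw [← hp', mul_inv]
    · simpa using hp'' φ

/-- The subgroup `P_O` of `I_O` of pairs `(xO, x x̄)` with `x ∈ Kˣ`. -/
def CMOrder.principalPolarisedIdeals (O : CMOrder K) (f : ℕ) :
    Subgroup (O.polarisedIdeals f) where
  carrier := {p | ∃ x : Kˣ, p.1.1 = principal O.carrier x ∧
    (((p.1.2 : (maximalRealSubfield K)ˣ) : maximalRealSubfield K) : K) =
      x * IsCMField.complexConj K x}
  one_mem' := ⟨1, by simp, by simp⟩
  mul_mem' := by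
    rintro p q ⟨x, hx, hx'⟩ ⟨y, hy, hy'⟩
    refine ⟨x * y, by simp [hx, hy], ?_⟩
    simp only [Prod.snd_mul, Units.val_mul, MulMemClass.coe_mul, map_mul, hx',
      hy']
    ring
  inv_mem' := by
    rintro p ⟨x, hx, hx'⟩
    refine ⟨x⁻¹, by simp [hx], ?_⟩
    simp [hx', mul_comm]

instance (O : CMOrder K) (f : ℕ) : (O.principalPolarisedIdeals f).Normal where
  conj_mem p hp q := by rwa [mul_comm q p, mul_inv_cancel_right]

/-- The polarised ideal class group `ℭ(O) = I_O / P_O`. -/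
abbrev CMOrder.PolarisedClassGroup (O : CMOrder K) (f : ℕ) : Type _ :=
  O.polarisedIdeals f ⧸ O.principalPolarisedIdeals f

/-- The class in `ℭ(O)` of an element of `I_O`. -/
def CMOrder.toClass (O : CMOrder K) (f : ℕ) : O.polarisedIdeals f →* O.PolarisedClassGroup f :=
  QuotientGroup.mk' (O.principalPolarisedIdeals f)

end Orders

section Reflex

variable {K : Type*} [Field K] [NumberField K]

/-- `Φ` is a CM-type of `K`: a set of representatives of the embeddings `K → ℂ` up to complex
conjugation. -/
def IsCMType (Φ : Finset (K →+* ℂ)) : Prop :=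
  ∀ φ : K →+* ℂ, Xor (φ ∈ Φ) (ComplexEmbedding.conjugate φ ∈ Φ)

/-- The reflex field, generated by the image of the type norm `x ↦ ∏_{φ ∈ Φ} φ(x)`. -/
def reflexField (Φ : Finset (K →+* ℂ)) : IntermediateField ℚ ℂ :=
  IntermediateField.adjoin ℚ (Set.range fun x : K => ∏ φ ∈ Φ, φ x)

theorem reflexField_le (Φ : Finset (K →+* ℂ)) :
    reflexField Φ ≤ IntermediateField.normalClosure ℚ K ℂ := by
  rw [reflexField, IntermediateField.adjoin_le_iff]
  rintro _ ⟨x, rfl⟩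
  exact prod_mem fun φ _ => AlgHom.fieldRange_le_normalClosure φ.toRatAlgHom ⟨x, rfl⟩

instance (Φ : Finset (K →+* ℂ)) : NumberField (reflexField Φ) where
  to_charZero := inferInstance
  to_finiteDimensional :=
    Module.Finite.of_injective (IntermediateField.inclusion (reflexField_le Φ)).toLinearMap
      (IntermediateField.inclusion (reflexField_le Φ)).injective

variable (Φ : Finset (K →+* ℂ)) (Kc : Type*) [Field Kc] [NumberField Kc] [Algebra K Kc]

instance : Finite (reflexField Φ →+* Kc) :=
  Finite.of_equiv _ (RingHom.equivRatAlgHom (reflexField Φ) Kc).symm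

/-- The reflex type: the embeddings `ψ⁻¹|_{Kʳ}` of the reflex field into the normal closure `Kc`
of `K`, for `ψ : Kc → ℂ` extending an element of `Φ`. -/
def reflexType : Finset (reflexField Φ →+* Kc) :=
  Set.Finite.toFinset (s := {τ | ∃ ψ : Kc →+* ℂ, ψ.comp (algebraMap K Kc) ∈ Φ ∧
    ∀ y : reflexField Φ, ψ (τ y) = y}) (Set.toFinite _)

/-- The reflex type norm of an invertible fractional ideal `𝔟` of `Kʳ`, given by the ideal
`∏_{τ ∈ Φʳ} τ(𝔟)𝓞_{Kc}` of `Kc`, which is the extension to `Kc` of an ideal of `K`. -/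
def reflexTypeNorm :
    (FractionalIdeal (𝓞 (reflexField Φ))⁰ (reflexField Φ))ˣ →* (Submodule (𝓞 Kc) Kc)ˣ :=
  ∏ τ ∈ reflexType Φ Kc, (Units.map (extend (R := 𝓞 (reflexField Φ)) (S := 𝓞 Kc) τ
    (fun r => ⟨RingOfIntegers.mapRingHom τ r, rfl⟩))).comp
    (Units.map (FractionalIdeal.coeSubmoduleHom _ _).toMonoidHom)

/-- The group `I_{Kʳ}(f)` of fractional ideals of `Kʳ` coprime to `f`. -/
def reflexIdeals (f : ℕ) :
    Subgroup (FractionalIdeal (𝓞 (reflexField Φ))⁰ (reflexField Φ))ˣ :=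
  (coprimeIdeals (𝓞 (reflexField Φ)) (reflexField Φ) f).comap
    (Units.map (FractionalIdeal.coeSubmoduleHom _ _).toMonoidHom)

variable [IsCMField K]

/-- The map `𝔟 ↦ (N_{Φʳ}(𝔟), N_{Kʳ/ℚ}(𝔟))` on `I_{Kʳ}(f)`, with its first component written as an
ideal of `Kc`. -/
def reflexPair (f : ℕ) :
    reflexIdeals Φ f →* (Submodule (𝓞 Kc) Kc)ˣ × (maximalRealSubfield K)ˣ :=
  ((reflexTypeNorm Φ Kc).prod
    ((Units.map (algebraMap ℚ (maximalRealSubfield K)).toMonoidHom).comp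
      (Units.map (FractionalIdeal.absNorm (R := 𝓞 (reflexField Φ))
        (K := reflexField Φ)).toMonoidHom))).comp (reflexIdeals Φ f).subtype

/-- The map `(𝔞, α) ↦ (𝔞𝓞_{Kc}, α)` on `I_O`. -/
def CMOrder.extendPair (O : CMOrder K) (f : ℕ) :
    O.polarisedIdeals f →* (Submodule (𝓞 Kc) Kc)ˣ × (maximalRealSubfield K)ˣ :=
  (MonoidHom.prodMap (Units.map (extend (R := O.carrier) (S := 𝓞 Kc) (algebraMap K Kc)
    (fun r => ⟨⟨algebraMap K Kc r, IsIntegral.map (algebraMap K Kc).toIntAlgHom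
      (IsIntegral.of_mem_of_fg O.carrier O.fg r.1 r.2)⟩, rfl⟩))) (MonoidHom.id _)).comp
    (O.polarisedIdeals f).subtype

/-- The kernel `S_O` of the map `I_{Kʳ}(f) → ℭ(O)` sending `𝔟` to the class of
`(N_{Φʳ}(𝔟), N_{Kʳ/ℚ}(𝔟))`: the ideals `𝔟` for which this pair, read as an element of `I_O` through
the map `(𝔞, α) ↦ (𝔞𝓞_{Kc}, α)`, has trivial class in `ℭ(O)`. -/
def CMOrder.S (O : CMOrder K) (f : ℕ) : Subgroup (reflexIdeals Φ f) :=
  ((O.toClass f).ker.map (O.extendPair Kc f)).comap (reflexPair Φ Kc f)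

end Reflex

end CMIndex

end

noncomputable section

namespace CMIndex

/-! ### Index of a subring and the relative discriminant. -/

section Index

/-! The hypothesis on the groups `S` forces the order to contain many specific elements. Write bars
for complex conjugation and let `y` be an integer of `K` coprime to the index `f`. The type norm `z`
of `y` generates an ideal of the reflex field. As `K` is not biquadratic, the reflex type has
exactly two elements, and the reflex type norm of `z` is `t = N(y)y/ȳ`, while the rational norm of
`z` is `N(y)² = t t̄` (`exists_reflex_norms`). So this ideal lies in `S` for the maximal order,
hence in `S` for the given order, which yields a `w` that generates an ideal of the order coprime to
`f`, with `w/t` a unit and `w w̄ = t t̄`. Units of relative norm one are `±1`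
(`eq_one_or_neg_one_of_mul_conj_eq_one`; here biquadratic fields and the fifth cyclotomic field are
excluded), so `w = ±t`. An integer generating an ideal coprime to the index lies in the order, hence
so does `t` (`mem_of_S_le`).

The rest is about a subring `R` of finite index `f` containing all these `t`. Approximating `x` by a
suitable `y` shows that the localisation of `R` at a prime `p` contains `x/x̄` for every `x` coprime
to `p` (`div_conj_mem_localization`). Applied to `x = i + e` with `ē = -e`, the quotients are Cayley
transforms, from which `e` can be recovered: exactly for `p ≥ 5`, and up to the factor `4p` for any
`p`. Hence `R` contains `ce` for all skew integers `e`, with `c = 144` (`mul_skew_mem`).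

Finally the index of such an `R` splits as the index of `R + 𝓞 K₀` in `𝓞 K` times the index of `R ∩
𝓞 K₀` in `𝓞 K₀`. The first divides `(2c)²`. The second is controlled by the ideal `c²𝔰`, where `𝔰`
is generated by products of two skew integers, and `𝔰` contains the relative discriminant because
the different lies in the ideal generated by skew integers (`index_sq_dvd_relDiscr`). -/

/-- In an order of rank two, a subgroup containing `1` and a non-zero ideal `I` has index whose
square divides the norm of `I`. -/
theorem index_sq_dvd_absNorm {F : Type*} [Field F] [NumberField F]
    (hF : Module.finrank ℚ F = 2) (I : Ideal (𝓞 F)) (hI : I ≠ ⊥) (H : AddSubgroup (𝓞 F))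
    (h1 : (1 : 𝓞 F) ∈ H) (hH : I.toAddSubgroup ≤ H) :
    H.index ^ 2 ∣ Ideal.absNorm I := by
  have hN : Ideal.absNorm I = I.toAddSubgroup.index := rfl
  have hN0 : Ideal.absNorm I ≠ 0 := by rwa [ne_eq, Ideal.absNorm_eq_zero_iff]
  -- `k` is the least positive integer in `I`. It divides `[H : I]` because `1 ∈ H`, while `N(I)`
  -- divides `N(k) = k²` because the rank is two; playing these against `N(I) = [H : I][𝓞 F : H]`
  -- gives the claim.
  set k := addOrderOf (QuotientAddGroup.mk (⟨1, h1⟩ : H) : H ⧸ I.toAddSubgroup.addSubgroupOf H)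
    with hk
  have hkd : k ∣ I.toAddSubgroup.relIndex H := addOrderOf_dvd_natCard _
  have hkI : (k : 𝓞 F) ∈ I := by
    have := addOrderOf_nsmul_eq_zero
      (QuotientAddGroup.mk (⟨1, h1⟩ : H) : H ⧸ I.toAddSubgroup.addSubgroupOf H)
    rw [← QuotientAddGroup.mk_nsmul, QuotientAddGroup.eq_zero_iff,
      AddSubgroup.mem_addSubgroupOf, ← hk] at this
    simpa using this
  have hdvd : Ideal.absNorm I ∣ k ^ 2 := by
    have h : Ideal.span {(k : 𝓞 F)} ≤ I := (Ideal.span_singleton_le_iff_mem _).2 hkI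
    have := Ideal.absNorm_dvd_absNorm_of_le h
    rw [Ideal.absNorm_span_singleton] at this
    have h2 : Algebra.norm ℤ (k : 𝓞 F) = (k : ℤ) ^ 2 := by
      have := Algebra.norm_algebraMap (S := 𝓞 F) (k : ℤ)
      rw [RingOfIntegers.rank, hF] at this
      simpa using this
    rw [h2] at this
    simpa [Int.natAbs_pow] using this
  obtain ⟨l, hl⟩ := hkd
  obtain ⟨m, hm⟩ := hdvd
  have hmul := AddSubgroup.relIndex_mul_index hH
  rw [← hN, hl] at hmul
  refine ⟨m * l ^ 2, ?_⟩
  apply Nat.eq_of_mul_eq_mul_left (Nat.pos_of_ne_zero hN0)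
  calc _ = (k * l * H.index) ^ 2 := by rw [hmul]; ring
    _ = k ^ 2 * (H.index ^ 2 * l ^ 2) := by ring
    _ = _ := by rw [hm]; ring

variable (K : Type*) [Field K] [NumberField K] [IsCMField K]

local notation "conjO" => IsCMField.ringOfIntegersComplexConj

/-- The ideal of the maximal order of the real subfield generated by the products of two integers
on which complex conjugation acts as `-1`. -/
def skewProducts : Ideal (𝓞 (maximalRealSubfield K)) :=
  Ideal.span {s | ∃ x y : 𝓞 K, conjO K x = -x ∧
    conjO K y = -y ∧
    algebraMap (𝓞 (maximalRealSubfield K)) (𝓞 K) s = x * y}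

variable {K}

theorem mem_range_of_conj_eq {x : 𝓞 K} (hx : conjO K x = x) :
    ∃ a : 𝓞 (maximalRealSubfield K), algebraMap _ _ a = x :=
  (IsCMField.ringOfIntegersComplexConj_eq_self_iff K x).1 hx

theorem algebraMap_conj (x : 𝓞 K) :
    algebraMap (𝓞 K) K (conjO K x) = IsCMField.complexConj K (algebraMap (𝓞 K) K x) := rfl

theorem conj_conj (x : 𝓞 K) : conjO K
    (conjO K x) = x := by
  apply RingOfIntegers.ext
  simp

theorem trace_eq_add_conj (x : K) :
    algebraMap (maximalRealSubfield K) K (Algebra.trace (maximalRealSubfield K) K x) =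
      x + IsCMField.complexConj K x := by
  classical
  have hne := IsCMField.complexConj_ne_one K
  have huniv : (Finset.univ : Finset (K ≃ₐ[maximalRealSubfield K] K)) =
      {1, IsCMField.complexConj K} := by
    symm
    apply Finset.eq_univ_of_card
    rw [Finset.card_pair hne.symm, ← Nat.card_eq_fintype_card, IsGalois.card_aut_eq_finrank,
      IsCMField.isQuadraticExtension K |>.finrank_eq_two]
  rw [trace_eq_sum_automorphisms, huniv, Finset.sum_pair hne.symm]
  rfl

theorem norm_eq_mul_conj (x : K) :
    algebraMap (maximalRealSubfield K) K (Algebra.norm (maximalRealSubfield K) x) =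
      x * IsCMField.complexConj K x := by
  classical
  have hne := IsCMField.complexConj_ne_one K
  have huniv : (Finset.univ : Finset (K ≃ₐ[maximalRealSubfield K] K)) =
      {1, IsCMField.complexConj K} := by
    symm
    apply Finset.eq_univ_of_card
    rw [Finset.card_pair hne.symm, ← Nat.card_eq_fintype_card, IsGalois.card_aut_eq_finrank,
      IsCMField.isQuadraticExtension K |>.finrank_eq_two]
  rw [Algebra.norm_eq_prod_automorphisms, huniv, Finset.prod_pair hne.symm]
  rfl

theorem intNorm_eq_mul_conj (x : 𝓞 K) :
    algebraMap (𝓞 (maximalRealSubfield K)) (𝓞 K)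
      (Algebra.intNorm (𝓞 (maximalRealSubfield K)) (𝓞 K) x) =
      x * conjO K x := by
  apply RingOfIntegers.ext
  have h := Algebra.algebraMap_intNorm (A := 𝓞 (maximalRealSubfield K))
    (K := maximalRealSubfield K) (L := K) x
  change _ = algebraMap (𝓞 K) K _
  rw [map_mul, algebraMap_conj, ← norm_eq_mul_conj, ← h]
  rfl

/-- There is a non-zero integer of a CM-field on which complex conjugation acts as `-1`. -/
theorem exists_skew_ne_zero : ∃ e : 𝓞 K, conjO K e = -e ∧ e ≠ 0 := by
  obtain ⟨x, hx⟩ : ∃ x : 𝓞 K, conjO K x ≠ x := by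
    by_contra! h
    apply IsCMField.complexConj_ne_one K
    ext x
    obtain ⟨a, b, hb, rfl⟩ := IsFractionRing.div_surjective (A := 𝓞 K) x
    have ha := congrArg (algebraMap (𝓞 K) K) (h a)
    have hb := congrArg (algebraMap (𝓞 K) K) (h b)
    rw [algebraMap_conj] at ha hb
    rw [map_div₀, ha, hb]
    rfl
  exact ⟨x - conjO K x, by rw [map_sub, conj_conj]; ring,
    fun h => hx (sub_eq_zero.1 h).symm⟩

-- By duality it is enough that traces of elements `z` of the inverse ideal are integral. For a skew
-- integer `e` the product `ze` is integral, and `ze` minus its conjugate equals `Tr(z)e`, again a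
-- skew integer. So `Tr(z)` stabilises the finitely generated group of skew integers.
variable (K) in
theorem differentIdeal_le_span_skew :
    differentIdeal (𝓞 (maximalRealSubfield K)) (𝓞 K) ≤
      Ideal.span {e : 𝓞 K | conjO K e = -e} := by
  set I := Ideal.span {e : 𝓞 K | conjO K e = -e} with hIdef
  obtain ⟨e₀, he₀, hne⟩ := exists_skew_ne_zero (K := K)
  have hI : I ≠ ⊥ := fun h => hne (by
    have : e₀ ∈ I := Ideal.subset_span he₀
    rwa [h, Ideal.mem_bot] at this)
  rw [differentialIdeal_le_iff (K := maximalRealSubfield K) (L := K) hI]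
  rintro _ ⟨z, hz, rfl⟩
  have hz' : ∀ e : 𝓞 K, conjO K e = -e →
      ∃ w : 𝓞 K, algebraMap (𝓞 K) K w = z * algebraMap (𝓞 K) K e := by
    intro e he
    have hz2 : z ∈ (I : FractionalIdeal (𝓞 K)⁰ K)⁻¹ := hz
    rw [FractionalIdeal.mem_inv_iff (by simpa using hI)] at hz2
    have := hz2 e (FractionalIdeal.mem_coeIdeal_of_mem _ (Ideal.subset_span he))
    obtain ⟨w, hw⟩ := (FractionalIdeal.mem_one_iff _).1 this
    exact ⟨w, hw⟩
  let N : Submodule ℤ K :=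
    { carrier := {x | ∃ e : 𝓞 K, conjO K e = -e ∧ (e : K) = x}
      add_mem' := by
        rintro _ _ ⟨a, ha, rfl⟩ ⟨b, hb, rfl⟩
        exact ⟨a + b, by rw [map_add, ha, hb]; ring, by simp⟩
      zero_mem' := ⟨0, by simp, by simp⟩
      smul_mem' := by
        rintro c _ ⟨a, ha, rfl⟩
        exact ⟨c • a, by rw [map_zsmul, ha, smul_neg], by simp⟩ }
  have hN : N.FG := by
    refine Submodule.FG.of_le
      ((Module.Finite.fg_top (R := ℤ) (M := 𝓞 K)).map ((Algebra.linearMap (𝓞 K) K).restrictScalars ℤ)) ?_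
    rintro _ ⟨e, -, rfl⟩
    exact ⟨e, trivial, rfl⟩
  have hint : IsIntegral ℤ (Algebra.trace (maximalRealSubfield K) K z) := by
    apply isIntegral_of_smul_mem_submodule N _ hN
    · rintro _ ⟨e, he, rfl⟩
      obtain ⟨w, hw⟩ := hz' e he
      refine ⟨w - conjO K w, by rw [map_sub, conj_conj]; ring, ?_⟩
      change algebraMap (𝓞 K) K _ = _
      have he' := congrArg (algebraMap (𝓞 K) K) he
      rw [algebraMap_conj, map_neg] at he'
      rw [map_sub, algebraMap_conj, hw, map_mul, he', Algebra.smul_def,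
        trace_eq_add_conj]
      change _ = _ * algebraMap (𝓞 K) K e
      ring
    · rw [Submodule.ne_bot_iff]
      exact ⟨e₀, ⟨e₀, he₀, rfl⟩, by simpa using hne⟩
  exact Submodule.mem_one.2 ⟨⟨_, hint⟩, rfl⟩

/-- Writing `x = ∑ vᵢeᵢ` with skew `eᵢ`, the product `x x̄` expands into terms `-vᵢv̄ᵢeᵢ²` and cross
terms `-(w + w̄)eᵢeⱼ` with `w = vᵢv̄ⱼ`. All are real multiples of products of two skew integers. The
auxiliary `h1` and `h2` handle the cross terms by induction in each variable, the free factor `w`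
absorbing the coefficients. -/
theorem mul_conj_mem_skewProducts {x : 𝓞 K}
    (hx : x ∈ Ideal.span {e : 𝓞 K | conjO K e = -e}) :
    ∃ s ∈ skewProducts K, algebraMap _ (𝓞 K) s = x * conjO K x := by
  set J := {e : 𝓞 K | conjO K e = -e}
  let T : Submodule (𝓞 (maximalRealSubfield K)) (𝓞 K) :=
    Submodule.map (Algebra.linearMap _ _) (skewProducts K)
  have hgen : ∀ e ∈ J, ∀ e' ∈ J, e * e' ∈ T := by
    intro e he e' he'
    obtain ⟨s, hs⟩ := mem_range_of_conj_eq (x := e * e') (by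
      rw [map_mul, he, he', neg_mul_neg])
    exact ⟨s, Ideal.subset_span ⟨e, e', he, he', hs⟩, hs⟩
  have hreal : ∀ a : 𝓞 K, conjO K a = a → ∀ t ∈ T, a * t ∈ T := by
    intro a ha t ht
    obtain ⟨s, rfl⟩ := mem_range_of_conj_eq ha
    rw [← Algebra.smul_def]
    exact T.smul_mem s ht
  have h1 : ∀ e ∈ J, ∀ y ∈ Ideal.span J, ∀ w : 𝓞 K,
      w * e * conjO K y + conjO K (w * e) * y ∈ T := by
    intro e he y hy
    induction hy using Submodule.span_induction with
    | mem y hy =>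
      intro w
      rw [show w * e * conjO K y + conjO K (w * e) * y = (w + conjO K w) * -(e * y) by
        rw [map_mul, he, hy]; ring]
      exact hreal _ (by rw [map_add, conj_conj, add_comm]) _ (neg_mem (hgen e he y hy))
    | zero => intro w; simp
    | add y z _ _ hy hz =>
      intro w
      convert add_mem (hy w) (hz w) using 1
      rw [map_add]; ring
    | smul v y _ hy =>
      intro w
      convert hy (w * conjO K v) using 1
      simp only [smul_eq_mul, map_mul, conj_conj]; ring
  have h2 : ∀ x ∈ Ideal.span J, ∀ y ∈ Ideal.span J, ∀ w : 𝓞 K,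
      w * x * conjO K y + conjO K (w * x) * y ∈ T := by
    intro x hx y hy
    induction hx using Submodule.span_induction with
    | mem x hx => exact h1 x hx y hy
    | zero => intro w; simp
    | add x z _ _ hx hz =>
      intro w
      convert add_mem (hx w) (hz w) using 1
      simp only [mul_add, map_add]; ring
    | smul v x _ hx =>
      intro w
      convert hx (w * v) using 1
      simp only [smul_eq_mul, mul_assoc]
  suffices x * conjO K x ∈ T from this
  induction hx using Submodule.span_induction with
  | mem x hx =>
    rw [show conjO K x = -x from hx, mul_neg]
    exact neg_mem (hgen x hx x hx)
  | zero => simp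
  | add x y hx hy hx' hy' =>
    convert add_mem (add_mem hx' hy') (h2 x hx y hy 1) using 1
    simp only [map_add, one_mul]; ring
  | smul v x _ hx =>
    convert hreal (v * conjO K v) (by rw [map_mul, conj_conj, mul_comm]) _ hx using 1
    simp only [smul_eq_mul, map_mul]; ring

-- The discriminant is generated by the relative norms `x x̄` of elements `x` of the different, so
-- the two preceding inclusions combine.
variable (K) in
theorem relDiscr_le_skewProducts : relDiscr (maximalRealSubfield K) K ≤ skewProducts K := by
  rw [relDiscr, Ideal.relNorm_apply, Ideal.span_le]
  rintro _ ⟨x, hx, rfl⟩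
  obtain ⟨s, hs, h⟩ := mul_conj_mem_skewProducts (differentIdeal_le_span_skew K hx)
  rw [← intNorm_eq_mul_conj] at h
  rwa [SetLike.mem_coe, ← FaithfulSMul.algebraMap_injective _ (𝓞 K) h]

variable (K) in
theorem finrank_maximalRealSubfield (hdeg : Module.finrank ℚ K = 4) :
    Module.finrank ℚ (maximalRealSubfield K) = 2 := by
  have := Module.finrank_mul_finrank ℚ (maximalRealSubfield K) K
  rw [hdeg, (IsCMField.isQuadraticExtension K).finrank_eq_two] at this
  omega

theorem index_span_natCast (F : Type*) [Field F] [NumberField F] (n : ℕ) :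
    (Ideal.span {(n : 𝓞 F)}).toAddSubgroup.index = n ^ Module.finrank ℚ F := by
  have h : Ideal.absNorm (Ideal.span {(n : 𝓞 F)}) =
    (Ideal.span {(n : 𝓞 F)}).toAddSubgroup.index := rfl
  rw [← h, Ideal.absNorm_span_singleton]
  have := Algebra.norm_algebraMap (S := 𝓞 F) (n : ℤ)
  rw [RingOfIntegers.rank] at this
  simp only [eq_intCast, Int.cast_natCast] at this
  rw [this, Int.natAbs_pow, Int.natAbs_natCast]

/-- If a subring `R` of the maximal order of a quartic CM-field contains `ce` for every integer `e`
on which complex conjugation acts as `-1`, then its index is bounded in terms of `c` and of the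
relative discriminant. -/
theorem index_sq_dvd_relDiscr (hdeg : Module.finrank ℚ K = 4) (R : Subring (𝓞 K)) (c : ℕ)
    (hc0 : c ≠ 0) (hc : ∀ e : 𝓞 K, conjO K e = -e → (c : 𝓞 K) * e ∈ R) :
    R.toAddSubgroup.index ^ 2 ∣
      2 ^ 4 * c ^ 8 * Ideal.absNorm (relDiscr (maximalRealSubfield K) K) := by
  have hdeg' := finrank_maximalRealSubfield K hdeg
  let ι : 𝓞 (maximalRealSubfield K) →+ 𝓞 K := (algebraMap _ _ : _ →+* _).toAddMonoidHom
  have hι : Function.Injective ι := FaithfulSMul.algebraMap_injective _ _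
  let A : AddSubgroup (𝓞 K) := ι.range
  let H := R.toAddSubgroup
  have key : ∀ G : AddSubgroup (𝓞 K), (G ⊔ A).index * (G.comap ι).index = G.index := by
    intro G
    rw [AddSubgroup.index_comap, ← AddSubgroup.relIndex_sup_right (K := G), sup_comm, mul_comm]
    exact AddSubgroup.relIndex_mul_index le_sup_right
  -- the index of `H + A`
  have h1 : (H ⊔ A).index ∣ (2 * c) ^ 2 := by
    -- `G = 2c𝓞 K` meets `𝓞 K₀` in `2c𝓞 K₀`, so `G + A` has index `(2c)⁴/(2c)² = (2c)²`. It lies in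
    -- `H + A` since `2cy = c(y - ȳ) + c(y + ȳ)`, the first summand being `c` times a skew integer
    -- and the second real.
    let G := (Ideal.span {((2 * c : ℕ) : 𝓞 K)}).toAddSubgroup
    have hG := key G
    have hGcomap : G.comap ι =
        (Ideal.span {((2 * c : ℕ) : 𝓞 (maximalRealSubfield K))}).toAddSubgroup := by
      ext a
      change algebraMap _ (𝓞 K) a ∈ Ideal.span _ ↔ a ∈ Ideal.span _
      rw [Ideal.mem_span_singleton, Ideal.mem_span_singleton]
      refine ⟨fun ⟨y, hy⟩ => ?_, fun ⟨b, hb⟩ => ⟨algebraMap _ _ b, by rw [hb, map_mul, map_natCast]⟩⟩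
      have hn : ((2 * c : ℕ) : 𝓞 K) ≠ 0 := Nat.cast_ne_zero.2 (by positivity)
      obtain ⟨b, rfl⟩ := mem_range_of_conj_eq (x := y) (mul_left_cancel₀ hn (by
        have := congrArg (conjO K) hy
        rw [map_mul, map_natCast] at this
        rw [← this, ← hy]
        simp))
      refine ⟨b, hι ?_⟩
      change algebraMap (𝓞 (maximalRealSubfield K)) (𝓞 K) _ =
        algebraMap (𝓞 (maximalRealSubfield K)) (𝓞 K) _
      rw [hy, map_mul, map_natCast]
    rw [hGcomap, index_span_natCast, index_span_natCast, hdeg, hdeg'] at hG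
    have : (G ⊔ A).index = (2 * c) ^ 2 := by
      apply Nat.eq_of_mul_eq_mul_right (m := (2 * c) ^ 2) (by positivity)
      rw [hG]; ring
    rw [← this]
    apply AddSubgroup.index_dvd_of_le
    refine sup_le ?_ le_sup_right
    intro x hx
    obtain ⟨y, rfl⟩ := Ideal.mem_span_singleton'.1 hx
    obtain ⟨a, ha⟩ := mem_range_of_conj_eq (x := y + conjO K y) (by
      rw [map_add, conj_conj, add_comm])
    rw [show y * ((2 * c : ℕ) : 𝓞 K) = c * (y - conjO K y) + c * (y + conjO K y) by
      push_cast; ring]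
    refine add_mem (AddSubgroup.mem_sup_left (hc _ ?_)) (AddSubgroup.mem_sup_right ?_)
    · rw [map_sub, conj_conj]; ring
    · exact ⟨c * a, by simp [ι, ha]⟩
  -- the index of `H ∩ A`
  have hne : skewProducts K ≠ ⊥ := by
    obtain ⟨e, he, he0⟩ := exists_skew_ne_zero (K := K)
    obtain ⟨s, hs⟩ := mem_range_of_conj_eq (x := e * e) (by rw [map_mul, he, neg_mul_neg])
    rw [Submodule.ne_bot_iff]
    refine ⟨s, Ideal.subset_span ⟨e, e, he, he, hs⟩, fun h => he0 ?_⟩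
    rw [h, map_zero] at hs
    exact mul_self_eq_zero.1 hs.symm
  have h2 : (H.comap ι).index ^ 2 ∣ c ^ 4 * Ideal.absNorm (skewProducts K) := by
    have hN : Ideal.absNorm (Ideal.span {((c ^ 2 : ℕ) : 𝓞 (maximalRealSubfield K))} *
        skewProducts K) = c ^ 4 * Ideal.absNorm (skewProducts K) := by
      rw [map_mul]
      congr 1
      change (Ideal.span {((c ^ 2 : ℕ) : 𝓞 (maximalRealSubfield K))}).toAddSubgroup.index = _
      rw [index_span_natCast, hdeg']; ring
    rw [← hN]
    apply index_sq_dvd_absNorm hdeg'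
    · exact mul_ne_zero (by simpa using hc0) hne
    · change algebraMap (𝓞 (maximalRealSubfield K)) (𝓞 K) 1 ∈ R
      simp
    · intro x hx
      obtain ⟨z, hz, rfl⟩ := Ideal.mem_span_singleton_mul.1 hx
      change algebraMap (𝓞 (maximalRealSubfield K)) (𝓞 K) _ ∈ R
      -- The real multiplier `a` is carried along so that the induction passes through scalar
      -- multiples; on generators `ee'` it is absorbed into `e`, which stays skew.
      have : ∀ z ∈ skewProducts K, ∀ a, algebraMap _ (𝓞 K) (((c ^ 2 : ℕ) : _) * (a * z)) ∈ R := by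
        intro z hz
        induction hz using Submodule.span_induction with
        | mem z hz =>
          obtain ⟨e, e', he, he', h⟩ := hz
          intro a
          have ha : conjO K (algebraMap _ (𝓞 K) a) = algebraMap _ (𝓞 K) a := by simp
          convert mul_mem (hc (algebraMap _ (𝓞 K) a * e) (by rw [map_mul, ha, he]; ring))
            (hc e' he') using 1
          simp only [map_mul, h, map_natCast]
          push_cast; ring
        | zero => intro a; simp
        | add z w _ _ hz hw =>
          intro a
          rw [mul_add, mul_add, map_add]
          exact add_mem (hz a) (hw a)
        | smul b z _ hz =>
          intro a
          rw [smul_eq_mul, ← mul_assoc a]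
          exact hz (a * b)
      simpa using this z hz 1
  have h3 := Ideal.absNorm_dvd_absNorm_of_le (relDiscr_le_skewProducts K)
  rw [← key H, mul_pow]
  refine (mul_dvd_mul (pow_dvd_pow_of_dvd h1 2) (h2.trans (mul_dvd_mul_left _ h3))).trans ?_
  rw [dvd_iff_exists_eq_mul_left]
  exact ⟨1, by ring⟩

end Index

/-! ### Recovering skew integers from quotients `x/x̄`, one prime at a time. -/

section Local

/-- An integer in a subring `R` divides its norm within `R`. -/
theorem exists_mem_mul_eq_norm {B : Type*} [CommRing B] [Module.Free ℤ B] [Module.Finite ℤ B]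
    (R : Subring B) {r : B} (hr : r ∈ R) : ∃ q ∈ R, r * q = (Algebra.norm ℤ r : ℤ) := by
  let P := (Algebra.lmul ℤ B r).charpoly
  have hP : Polynomial.aeval r P = 0 := by
    have h := LinearMap.aeval_self_charpoly (Algebra.lmul ℤ B r)
    rw [Polynomial.aeval_algHom_apply] at h
    have := LinearMap.congr_fun h 1
    simpa [P] using this
  -- By Cayley–Hamilton, `r` times this polynomial in `r` is minus the constant coefficient, which
  -- is the norm up to sign.
  have hq : Polynomial.aeval r P.divX ∈ R := by
    have : Algebra.adjoin ℤ {r} ≤ subalgebraOfSubring R := by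
      rw [Algebra.adjoin_le_iff, Set.singleton_subset_iff]
      exact hr
    exact this (Polynomial.aeval_mem_adjoin_singleton ℤ r)
  have hnorm : Algebra.norm ℤ r = (-1) ^ Module.finrank ℤ B * P.coeff 0 := by
    rw [Algebra.norm_apply]
    exact LinearMap.det_eq_sign_charpoly_coeff _
  refine ⟨-((-1) ^ Module.finrank ℤ B) * Polynomial.aeval r P.divX,
    mul_mem (neg_mem (pow_mem (neg_mem (one_mem _)) _)) hq, ?_⟩
  rw [← Polynomial.X_mul_divX_add P, map_add, map_mul, Polynomial.aeval_X,
    Polynomial.aeval_C] at hP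
  rw [hnorm]
  push_cast
  simp only [eq_intCast] at hP
  linear_combination -((-1) ^ Module.finrank ℤ B) * hP

/-- If `ay + bm = 1`, then `ay = 1 - bm` has norm congruent to `1` modulo `m`. -/
theorem isCoprime_norm {B : Type*} [CommRing B] [Module.Free ℤ B] [Module.Finite ℤ B]
    {y : B} {m : ℕ} (h : IsCoprime y (m : B)) : IsCoprime (Algebra.norm ℤ y) (m : ℤ) := by
  obtain ⟨a, b, hab⟩ := h
  obtain ⟨c, hc⟩ := Algebra.norm_one_add_smul (A := ℤ) (m : ℤ) (-b)
  have h1 : (1 : B) + (m : ℤ) • (-b) = a * y := by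
    rw [zsmul_eq_mul]
    push_cast
    linear_combination -hab
  rw [h1, map_mul] at hc
  exact ⟨Algebra.norm ℤ a, -(Algebra.trace ℤ B (-b) + c * m), by linear_combination hc⟩

theorem exists_monic_quadratic {F : Type*} [Field F] [NumberField F]
    (hF : Module.finrank ℚ F = 2) (a : 𝓞 F) : ∃ s n : ℤ, a ^ 2 + s * a + n = 0 := by
  let P := (Algebra.lmul ℤ (𝓞 F) a).charpoly
  have hP : Polynomial.aeval a P = 0 := by
    have h := LinearMap.aeval_self_charpoly (Algebra.lmul ℤ (𝓞 F) a)
    rw [Polynomial.aeval_algHom_apply] at h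
    have := LinearMap.congr_fun h 1
    simpa [P] using this
  have hdeg : P.natDegree = 2 := by
    rw [LinearMap.charpoly_natDegree, RingOfIntegers.rank, hF]
  have hm : P.coeff 2 = 1 := by
    rw [← hdeg]
    exact LinearMap.charpoly_monic _
  refine ⟨P.coeff 1, P.coeff 0, ?_⟩
  rw [Polynomial.aeval_eq_sum_range, hdeg] at hP
  simp only [Finset.sum_range_succ, Finset.sum_range_zero, hm, zsmul_eq_mul] at hP
  push_cast at hP
  linear_combination hP

variable {K : Type*} [Field K]

/-- The localisation at the prime `p` of a subring of the maximal order. -/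
def localization (R : Subring (𝓞 K)) (p : ℕ) (hp : p.Prime) : Subring K where
  carrier := {s | ∃ n : ℤ, ¬ (p : ℤ) ∣ n ∧ ∃ r ∈ R, n * s = algebraMap (𝓞 K) K r}
  mul_mem' := by
    rintro s t ⟨n, hn, r, hr, h⟩ ⟨m, hm, q, hq, h'⟩
    refine ⟨n * m, fun hd => ?_, r * q, mul_mem hr hq, ?_⟩
    · exact ((Nat.prime_iff_prime_int.1 hp).dvd_or_dvd hd).elim hn hm
    · rw [map_mul, ← h, ← h']; push_cast; ring
  one_mem' := ⟨1, fun hd => (Nat.prime_iff_prime_int.1 hp).not_dvd_one hd, 1, one_mem _, by simp⟩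
  add_mem' := by
    rintro s t ⟨n, hn, r, hr, h⟩ ⟨m, hm, q, hq, h'⟩
    refine ⟨n * m, fun hd => ?_, m * r + n * q, ?_, ?_⟩
    · exact ((Nat.prime_iff_prime_int.1 hp).dvd_or_dvd hd).elim hn hm
    · exact add_mem (mul_mem (intCast_mem _ _) hr) (mul_mem (intCast_mem _ _) hq)
    · rw [map_add, map_mul, map_mul, ← h, ← h', map_intCast, map_intCast]; push_cast; ring
  zero_mem' := ⟨1, fun hd => (Nat.prime_iff_prime_int.1 hp).not_dvd_one hd, 0, zero_mem _, by simp⟩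
  neg_mem' := by
    rintro s ⟨n, hn, r, hr, h⟩
    exact ⟨n, hn, -r, neg_mem hr, by rw [map_neg, ← h]; ring⟩

variable {R : Subring (𝓞 K)} {p : ℕ} {hp : p.Prime}

theorem mem_localization_of_mem {r : 𝓞 K} (hr : r ∈ R) :
    algebraMap (𝓞 K) K r ∈ localization R p hp :=
  ⟨1, fun hd => (Nat.prime_iff_prime_int.1 hp).not_dvd_one hd, r, hr, by simp⟩

theorem mem_localization_of_mul {n : ℤ} (hn : ¬ (p : ℤ) ∣ n) {s : K}
    (h : n * s ∈ localization R p hp) : s ∈ localization R p hp := by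
  obtain ⟨m, hm, r, hr, h⟩ := h
  refine ⟨m * n, fun hd => ?_, r, hr, by rw [← h]; push_cast; ring⟩
  exact ((Nat.prime_iff_prime_int.1 hp).dvd_or_dvd hd).elim hm hn

/-- The integers `n` with `ns ∈ R` form an ideal of `ℤ`. Being locally in `R` means that no prime
contains this ideal, so it contains `1`. -/
theorem mem_of_forall_mem_localization {s : 𝓞 K}
    (h : ∀ (p : ℕ) (hp : p.Prime), algebraMap (𝓞 K) K s ∈ localization R p hp) : s ∈ R := by
  let I : Ideal ℤ :=
    { carrier := {n | (n : 𝓞 K) * s ∈ R}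
      add_mem' := fun {a b} ha hb => by
        simp only [Set.mem_ofPred_eq] at *
        rw [Int.cast_add, add_mul]; exact add_mem ha hb
      zero_mem' := by simp
      smul_mem' := fun a b hb => by
        simp only [Set.mem_ofPred_eq, smul_eq_mul] at *
        rw [Int.cast_mul, mul_assoc]; exact mul_mem (intCast_mem _ _) hb }
  suffices hI : I = ⊤ by
    have : (1 : ℤ) ∈ I := hI ▸ trivial
    simpa [I] using this
  by_contra hI
  obtain ⟨M, hM, hIM⟩ := Ideal.exists_le_maximal I hI
  obtain ⟨g, hg⟩ := IsPrincipalIdealRing.principal M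
  have hM0 : M ≠ ⊥ := fun h0 => by
    rw [h0] at hM
    exact Int.not_isField (Ring.isField_iff_maximal_bot.2 hM)
  have hg' : M = Ideal.span {g} := hg
  have hg0 : g ≠ 0 := by rintro rfl; exact hM0 (by rw [hg']; simp)
  have hgp : Prime g := (Ideal.span_singleton_prime hg0).1 (hg' ▸ hM.isPrime)
  obtain ⟨n, hn, r, hr, hnr⟩ := h g.natAbs (Int.prime_iff_natAbs_prime.1 hgp)
  have hnI : n ∈ I := by
    have : (n : 𝓞 K) * s = r := RingOfIntegers.ext (by
      change algebraMap (𝓞 K) K _ = algebraMap (𝓞 K) K _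
      rw [← hnr, map_mul, map_intCast])
    change (n : 𝓞 K) * s ∈ R
    rwa [this]
  have := hIM hnI
  rw [hg', Ideal.mem_span_singleton] at this
  exact hn (Int.natAbs_dvd.2 this)

variable [NumberField K]

/-- The inverse of an element of a localised order is in that order as soon as it is integral. -/
theorem mem_localization_of_inv_mem {x : 𝓞 K}
    (h : (algebraMap (𝓞 K) K x)⁻¹ ∈ localization R p hp) (hx : x ≠ 0) :
    algebraMap (𝓞 K) K x ∈ localization R p hp := by
  obtain ⟨n, hn, r, hr, h⟩ := h
  have hp' := Nat.prime_iff_prime_int.1 hp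
  have hx' : algebraMap (𝓞 K) K x ≠ 0 := by simpa using hx
  have hrx : r * x = n := by
    apply RingOfIntegers.ext
    change algebraMap (𝓞 K) K _ = algebraMap (𝓞 K) K _
    rw [map_mul, ← h, map_intCast, mul_assoc, inv_mul_cancel₀ hx', mul_one]
  obtain ⟨q, hq, hrq⟩ := exists_mem_mul_eq_norm R hr
  -- Since `rx = n`, the norm of `r` divides a power of `n`. With `rq = N(r)` and `q ∈ R`, one then
  -- has `N(r)x = nq ∈ R`.
  have hN : ¬ (p : ℤ) ∣ Algebra.norm ℤ r := by
    intro hd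
    have h1 := congrArg (Algebra.norm ℤ) hrx
    have h2 := Algebra.norm_algebraMap (S := 𝓞 K) n
    simp only [eq_intCast] at h2
    rw [map_mul, h2] at h1
    exact hn (hp'.dvd_of_dvd_pow (h1 ▸ hd.mul_right _))
  refine mem_localization_of_mul hN ?_
  have : (Algebra.norm ℤ r : K) * algebraMap (𝓞 K) K x = algebraMap (𝓞 K) K (n * q) := by
    rw [← hrx, ← map_intCast (algebraMap (𝓞 K) K), ← hrq, ← map_mul]
    congr 1; ring
  rw [this]
  exact mem_localization_of_mem (mul_mem (intCast_mem _ _) hq)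

theorem norm_not_dvd {x : 𝓞 K} (hp : p.Prime) (h : IsCoprime x (p : 𝓞 K)) :
    ¬ (p : ℤ) ∣ Algebra.norm ℤ x := fun hd =>
  (Nat.prime_iff_prime_int.1 hp).not_isUnit ((isCoprime_norm h).isUnit_of_dvd' hd dvd_rfl)

theorem ne_zero_of_isCoprime {x : 𝓞 K} (hp : p.Prime) (h : IsCoprime x (p : 𝓞 K)) : x ≠ 0 := by
  rintro rfl
  apply norm_not_dvd hp h
  rw [Algebra.norm_zero]
  exact dvd_zero _

variable [IsCMField K]

local notation "conjO" => IsCMField.ringOfIntegersComplexConj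

theorem conj_isCoprime {x : 𝓞 K} {m : ℕ} (h : IsCoprime x (m : 𝓞 K)) :
    IsCoprime (conjO K x) (m : 𝓞 K) := by
  simpa using h.map (conjO K : 𝓞 K →+* 𝓞 K)

/-- A subring of finite index in the maximal order that contains the products `N(y)y/ȳ` with `y`
coprime to its index contains locally all quotients `x/x̄`. -/
theorem div_conj_mem_localization (hR : R.toAddSubgroup.index ≠ 0)
    (hT : ∀ y t : 𝓞 K, IsCoprime y (R.toAddSubgroup.index : 𝓞 K) →
      t * conjO K y = (Algebra.norm ℤ y : 𝓞 K) * y → t ∈ R)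
    {x : 𝓞 K} (hx : IsCoprime x (p : 𝓞 K)) :
    algebraMap (𝓞 K) K x / algebraMap (𝓞 K) K (conjO K x) ∈ localization R p hp := by
  have hp' := Nat.prime_iff_prime_int.1 hp
  set f := R.toAddSubgroup.index with hf
  obtain ⟨k, r, hr, hkr⟩ := Nat.exists_eq_pow_mul_and_not_dvd hR p hp.ne_one
  obtain ⟨α, β, hαβ⟩ : IsCoprime ((p : ℤ) ^ (k + 1)) r :=
    IsCoprime.pow_left (Nat.isCoprime_iff_coprime.2 ((Nat.Prime.coprime_iff_not_dvd hp).2 hr))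
  have hαβ' : (α : 𝓞 K) * (p : 𝓞 K) ^ (k + 1) + β * r = 1 := by
    have := congrArg (Int.cast : ℤ → 𝓞 K) hαβ
    push_cast at this
    exact this
  have hfr : (p : 𝓞 K) ^ k * r = f := by rw [hkr]; push_cast; rfl
  -- With `f = pᵏr`, this `y` is congruent to `x` modulo `pᵏ⁺¹` and to `1` modulo `r`. The exponent
  -- `k + 1` keeps `y` coprime to `p` even when `p` does not divide `f`.
  set y : 𝓞 K := x + (p : 𝓞 K) ^ (k + 1) * (α * (1 - x)) with hy
  have hyp : IsCoprime y ((p : 𝓞 K) ^ (k + 1)) :=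
    (hx.pow_right).add_mul_left_left _
  have hyp1 : IsCoprime y (p : 𝓞 K) := (IsCoprime.pow_right_iff (Nat.succ_pos k)).1 hyp
  have hyr : IsCoprime y (r : 𝓞 K) := by
    have : y = 1 + (r : 𝓞 K) * (β * (x - 1)) := by rw [hy]; linear_combination (1 - x) * hαβ'
    rw [this]
    exact isCoprime_one_left.add_mul_left_left _
  have hyf : IsCoprime y (f : 𝓞 K) := by
    rw [← hfr]
    exact (hyp1.pow_right).mul_right hyr
  obtain ⟨y', -, hy'⟩ := exists_mem_mul_eq_norm (⊤ : Subring (𝓞 K)) (Subring.mem_top y)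
  obtain ⟨x', -, hx'⟩ := exists_mem_mul_eq_norm (⊤ : Subring (𝓞 K)) (Subring.mem_top x)
  have hyc : conjO K y * conjO K y' = (Algebra.norm ℤ y : ℤ) := by
    rw [← map_mul, hy', map_intCast]
  have hxc : conjO K x * conjO K x' = (Algebra.norm ℤ x : ℤ) := by
    rw [← map_mul, hx', map_intCast]
  have htR : conjO K y' * y ∈ R := hT y _ hyf (by rw [← hyc]; ring)
  set n := Algebra.norm ℤ x
  set m := Algebra.norm ℤ y
  have hn : ¬ (p : ℤ) ∣ n := norm_not_dvd hp hx
  have hm : ¬ (p : ℤ) ∣ m := norm_not_dvd hp hyp1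
  -- The difference `x/x̄ - y/ȳ` has numerator `xȳ - x̄y`, a multiple of `pᵏ⁺¹`. Multiplication by
  -- `r` makes it a multiple of `f`, and `f𝓞 K` lies in `R`; the norms `n` and `m` clear the
  -- denominators `x̄` and `ȳ`.
  refine ⟨n * (m * r), fun hd => ?_, n * (r * (conjO K y' * y)) +
    f * (p * conjO K x' * conjO K y' *
      (x * conjO K (α * (1 - x)) - conjO K x * (α * (1 - x)))), ?_, ?_⟩
  · rcases hp'.dvd_or_dvd hd with h | h
    · exact hn h
    rcases hp'.dvd_or_dvd h with h | h
    · exact hm h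
    · exact hr (Int.natCast_dvd_natCast.1 h)
  · refine add_mem (mul_mem (intCast_mem _ _) (mul_mem (natCast_mem _ _) htR)) ?_
    rw [← nsmul_eq_mul]
    exact R.toAddSubgroup.nsmul_index_mem _
  · have hx0 : algebraMap (𝓞 K) K (conjO K x) ≠ 0 := by
      have := ne_zero_of_isCoprime hp (conj_isCoprime hx)
      simpa using this
    rw [mul_div_assoc', div_eq_iff hx0, ← map_intCast (algebraMap (𝓞 K) K), ← map_mul, ← map_mul]
    congr 1
    have hyb : conjO K y = conjO K x + (p : 𝓞 K) ^ (k + 1) * conjO K (α * (1 - x)) := by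
      rw [hy]; simp
    push_cast
    rw [hyb] at hyc
    rw [← hfr]
    linear_combination (-(n * r * x) : 𝓞 K) * hyc - (r * (p : 𝓞 K) ^ (k + 1) * conjO K y' *
      (x * conjO K (α * (1 - x)) - conjO K x * (α * (1 - x)))) * hxc

section Skew

variable (hR : R.toAddSubgroup.index ≠ 0)
  (hu : ∀ x : 𝓞 K, IsCoprime x (p : 𝓞 K) →
    algebraMap (𝓞 K) K x / algebraMap (𝓞 K) K (conjO K x) ∈ localization R p hp)

-- With `u = pe`, the identity `(1+u)/(1-u) - (1-u)/(1+u) = 4u/(1-u²)` gives `4u` up to a correction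
-- by a factor `u²`, which is divisible by `p²`. A descending induction on the power of `p` in
-- front, starting from the one that divides `f`, removes the correction.
include hR hu in
theorem four_mul_prime_mul_skew_mem {e : 𝓞 K} (he : conjO K e = -e) :
    algebraMap (𝓞 K) K (4 * p * e) ∈ localization R p hp := by
  obtain ⟨k, r, hr, hkr⟩ := Nat.exists_eq_pow_mul_and_not_dvd hR p hp.ne_one
  have key : ∀ j ≤ k, ∀ e : 𝓞 K, conjO K e = -e →
      algebraMap (𝓞 K) K ((p : 𝓞 K) ^ j * (4 * p * e)) ∈ localization R p hp := by
    intro j hj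
    induction hj using Nat.decreasingInduction with
    | self =>
      intro e he
      refine mem_localization_of_mul (n := r) (fun h => hr (Int.natCast_dvd_natCast.1 h)) ?_
      rw [Int.cast_natCast, ← map_natCast (algebraMap (𝓞 K) K), ← map_mul]
      apply mem_localization_of_mem
      have : (r : 𝓞 K) * ((p : 𝓞 K) ^ k * (4 * p * e)) =
          R.toAddSubgroup.index • (4 * p * e) := by
        rw [nsmul_eq_mul, hkr]; push_cast; ring
      rw [this]
      exact R.toAddSubgroup.nsmul_index_mem _
    | of_succ j _ ih =>
      intro e he
      have hx : IsCoprime (1 + (p : 𝓞 K) * e) (p : 𝓞 K) := isCoprime_one_left.add_mul_left_left e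
      have hx' : IsCoprime (1 - (p : 𝓞 K) * e) (p : 𝓞 K) := by
        rw [sub_eq_add_neg, ← mul_neg]
        exact isCoprime_one_left.add_mul_left_left _
      have hc : conjO K (1 + (p : 𝓞 K) * e) = 1 - (p : 𝓞 K) * e := by simp [he, sub_eq_add_neg]
      have hc' : conjO K (1 - (p : 𝓞 K) * e) = 1 + (p : 𝓞 K) * e := by simp [he]
      have h1 := hu _ hx
      have h2 := hu _ hx'
      rw [hc] at h1
      rw [hc'] at h2
      obtain ⟨q, -, hq⟩ := exists_mem_mul_eq_norm (⊤ : Subring (𝓞 K)) (Subring.mem_top (1 + p * e))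
      have hq' : (1 - p * e) * conjO K q = (Algebra.norm ℤ (1 + p * e) : ℤ) := by
        rw [← hc, ← map_mul, hq, map_intCast]
      have hn := norm_not_dvd hp hx
      set n := Algebra.norm ℤ (1 + p * e)
      have h0 : algebraMap (𝓞 K) K (1 + p * e) ≠ 0 :=
        (map_ne_zero_iff _ (FaithfulSMul.algebraMap_injective (𝓞 K) K)).2 (ne_zero_of_isCoprime hp hx)
      have h0' : algebraMap (𝓞 K) K (1 - p * e) ≠ 0 :=
        (map_ne_zero_iff _ (FaithfulSMul.algebraMap_injective (𝓞 K) K)).2 (ne_zero_of_isCoprime hp hx')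
      -- After clearing denominators by `n² = (1+pe)(1-pe)q q̄`, the correction term is `p` times
      -- the induction hypothesis for this integer, which is skew because `q q̄` is real.
      have h3 := ih (e ^ 3 * (q * conjO K q)) (by
        simp only [map_mul, map_pow, he, conj_conj]; ring)
      refine mem_localization_of_mul (n := n ^ 2)
        (fun h => hn ((Nat.prime_iff_prime_int.1 hp).dvd_of_dvd_pow h)) ?_
      have hid : ((n ^ 2 : ℤ) : K) * algebraMap (𝓞 K) K ((p : 𝓞 K) ^ j * (4 * p * e)) =
          algebraMap (𝓞 K) K ((n : 𝓞 K) ^ 2 * (p : 𝓞 K) ^ j) *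
            (algebraMap (𝓞 K) K (1 + p * e) / algebraMap (𝓞 K) K (1 - p * e) -
              algebraMap (𝓞 K) K (1 - p * e) / algebraMap (𝓞 K) K (1 + p * e)) -
          p * algebraMap (𝓞 K) K
            ((p : 𝓞 K) ^ (j + 1) * (4 * p * (e ^ 3 * (q * conjO K q)))) := by
        have hqK := congrArg (algebraMap (𝓞 K) K) hq
        have hqK' := congrArg (algebraMap (𝓞 K) K) hq'
        simp only [map_mul, map_pow, map_add, map_sub, map_one, map_natCast, map_intCast,
          map_ofNat] at *
        have hn2 : (n : K) ^ 2 = (1 + p * algebraMap (𝓞 K) K e) * (1 - p * algebraMap (𝓞 K) K e) *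
            (algebraMap (𝓞 K) K q * algebraMap (𝓞 K) K (conjO K q)) := by
          rw [sq]
          nth_rewrite 1 [← hqK]
          rw [← hqK']
          ring
        rw [Int.cast_pow, hn2]
        field_simp
        ring
      rw [hid]
      refine sub_mem (mul_mem (mem_localization_of_mem ?_) (sub_mem h1 h2))
        (mul_mem (natCast_mem _ _) h3)
      exact mul_mem (pow_mem (intCast_mem _ _) _) (pow_mem (natCast_mem _ _) _)
  simpa using key 0 (Nat.zero_le _) e he

-- For `x = i + e` one has `x/x̄ + 1 = 2i/(i - e)`. As `2i` is a unit at `p`, the inverse of `i - e`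
-- lies in the localisation, hence so does the integer `i - e` itself.
include hu in
theorem skew_mem_of_isCoprime_add (hp2 : p ≠ 2) {e : 𝓞 K} (he : conjO K e = -e) {i : ℤ}
    (hi : ¬ (p : ℤ) ∣ i) (hie : IsCoprime (i + e) (p : 𝓞 K)) :
    algebraMap (𝓞 K) K e ∈ localization R p hp := by
  have hc : conjO K (i + e) = i - e := by simp [he, sub_eq_add_neg]
  have hie' := conj_isCoprime hie
  have h := hu _ hie
  rw [hc] at h hie'
  have hne := ne_zero_of_isCoprime hp hie'
  have h0 : algebraMap (𝓞 K) K (i - e) ≠ 0 :=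
    (map_ne_zero_iff _ (FaithfulSMul.algebraMap_injective (𝓞 K) K)).2 hne
  have h2 : (algebraMap (𝓞 K) K (i - e))⁻¹ ∈ localization R p hp := by
    refine mem_localization_of_mul (n := 2 * i) (fun hd => ?_) ?_
    · rcases (Nat.prime_iff_prime_int.1 hp).dvd_or_dvd hd with h | h
      · exact hp2 ((Nat.prime_dvd_prime_iff_eq hp Nat.prime_two).1 (by exact_mod_cast h))
      · exact hi h
    · convert add_mem h (one_mem _) using 1
      rw [div_add_one h0, ← div_eq_mul_inv]
      congr 1
      rw [← map_add, show (i : 𝓞 K) + e + (i - e) = ((2 * i : ℤ) : 𝓞 K) by push_cast; ring,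
        map_intCast]
  have h3 := mem_localization_of_inv_mem h2 hne
  have h4 : algebraMap (𝓞 K) K e = i - algebraMap (𝓞 K) K (i - e) := by simp
  rw [h4]
  exact sub_mem (intCast_mem _ _) h3

-- Since `e²` is real, `e` is a root of some `X⁴ + sX² + n`. If an integer `i` prime to `p` is not a
-- root modulo `p`, then `i + e` is coprime to `p` and the previous lemma applies. Testing `i = 1,
-- 2, 3`, whose squares are distinct modulo `p` for `p > 5`, leaves only `p = 5` with the polynomial
-- congruent to `X⁴ - 1`.
include hu in
theorem skew_mem_of_five_le (hdeg : Module.finrank ℚ K = 4) (hp5 : 5 ≤ p) {e : 𝓞 K}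
    (he : conjO K e = -e) : algebraMap (𝓞 K) K e ∈ localization R p hp := by
  have hp' := Nat.prime_iff_prime_int.1 hp
  obtain ⟨a, ha⟩ := mem_range_of_conj_eq (x := e ^ 2) (by rw [map_pow, he, neg_sq])
  obtain ⟨s, n, hsn⟩ := exists_monic_quadratic (finrank_maximalRealSubfield K hdeg) a
  have hquart : e ^ 4 + s * e ^ 2 + n = 0 := by
    have := congrArg (algebraMap _ (𝓞 K)) hsn
    simp only [map_add, map_mul, map_pow, map_intCast, ha, map_zero] at this
    linear_combination this
  have hcop : ∀ i : ℤ, ¬ (p : ℤ) ∣ i → ¬ (p : ℤ) ∣ i ^ 4 + s * i ^ 2 + n →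
      algebraMap (𝓞 K) K e ∈ localization R p hp := by
    intro i hi hd
    refine skew_mem_of_isCoprime_add hu (by omega) he hi ?_
    have h1 : IsCoprime (i ^ 4 + s * i ^ 2 + n) (p : ℤ) :=
      ((Prime.coprime_iff_not_dvd hp').2 hd).symm
    have h2 := h1.map (Int.castRingHom (𝓞 K))
    have h3 : Int.castRingHom (𝓞 K) (i ^ 4 + s * i ^ 2 + n) =
        (i + e) * ((i - e) * (i ^ 2 + e ^ 2 + s)) := by
      simp only [eq_intCast]
      push_cast
      linear_combination hquart
    rw [h3] at h2
    simpa using h2.of_mul_left_left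
  have hsmall : ∀ i : ℤ, 0 < i → i < p → ¬ (p : ℤ) ∣ i := fun i h0 h1 h2 =>
    absurd (Int.le_of_dvd h0 h2) (by omega)
  by_contra hcon
  have hd : ∀ i : ℤ, 0 < i → i < p → (p : ℤ) ∣ i ^ 4 + s * i ^ 2 + n := fun i h0 h1 => by
    by_contra h
    exact hcon (hcop i (hsmall i h0 h1) h)
  have hd1 := hd 1 (by omega) (by omega)
  have hd2 := hd 2 (by omega) (by omega)
  have hd3 := hd 3 (by omega) (by omega)
  have h12 : (p : ℤ) ∣ 3 * (5 + s) := by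
    rw [show 3 * (5 + s) = 2 ^ 4 + s * 2 ^ 2 + n - (1 ^ 4 + s * 1 ^ 2 + n) by ring]
    exact dvd_sub hd2 hd1
  have h23 : (p : ℤ) ∣ 5 * (13 + s) := by
    rw [show 5 * (13 + s) = 3 ^ 4 + s * 3 ^ 2 + n - (2 ^ 4 + s * 2 ^ 2 + n) by ring]
    exact dvd_sub hd3 hd2
  have h5s := (hp'.dvd_or_dvd h12).resolve_left (hsmall 3 (by omega) (by omega))
  have hp5' : p = 5 := by
    by_contra hne
    have h13s := (hp'.dvd_or_dvd h23).resolve_left (hsmall 5 (by omega) (by omega))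
    have h8 : (p : ℤ) ∣ 2 ^ 3 := by
      rw [show (2 : ℤ) ^ 3 = 13 + s - (5 + s) by ring]
      exact dvd_sub h13s h5s
    exact hsmall 2 (by omega) (by omega) (hp'.dvd_of_dvd_pow h8)
  subst hp5'
  obtain ⟨g, hg⟩ : ∃ g : 𝓞 K, e ^ 4 = 1 + 5 * g := by
    obtain ⟨s', hs'⟩ : (5 : ℤ) ∣ s := by push_cast at h5s; omega
    obtain ⟨n', hn'⟩ : (5 : ℤ) ∣ n + 1 := by push_cast at hd1; omega
    refine ⟨-(s' * e ^ 2) - n', ?_⟩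
    have h1 : (s : 𝓞 K) = 5 * s' := by rw [hs']; push_cast; rfl
    have h2 : (n : 𝓞 K) + 1 = 5 * n' := by exact_mod_cast congrArg (Int.cast : ℤ → 𝓞 K) hn'
    linear_combination hquart - e ^ 2 * h1 - h2
  -- Here `e⁴ ≡ 1` modulo `5`, so `e` reduces into `𝔽₅ˣ` at each prime above `5`. There both `e +
  -- e³` and `2(e - e³)` take values in `{0, ±2}` only, never `-1`, so adding `1` makes them coprime
  -- to `5`. Twice the first plus the second is `4e`.
  have hc1 : conjO K (e + e ^ 3) = -(e + e ^ 3) := by rw [map_add, map_pow, he]; ring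
  have hc2 : conjO K (2 * (e - e ^ 3)) = -(2 * (e - e ^ 3)) := by
    rw [map_mul, map_sub, map_pow, he, map_ofNat]; ring
  have h1 := skew_mem_of_isCoprime_add hu (by norm_num) hc1 (i := 1) (by norm_num)
    ⟨(1 - (e + e ^ 3)) * (2 + e ^ 2), 1 + e ^ 2 + 7 * g + 4 * g * e ^ 2 + 5 * g ^ 2, by
      push_cast
      linear_combination (-5 - 4 * e ^ 2 - e ^ 4 - 1 - 5 * g) * hg⟩
  have h2 := skew_mem_of_isCoprime_add hu (by norm_num) hc2 (i := 1) (by norm_num)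
    ⟨(1 - 2 * (e - e ^ 3)) * (4 * e ^ 2 + 2), 3 - 4 * e ^ 2 - 24 * g * e ^ 2 + 32 * g + 80 * g ^ 2,
      by
      push_cast
      linear_combination (24 * e ^ 2 - 16 * e ^ 4 - 16 - 80 * g) * hg⟩
  apply hcon
  refine mem_localization_of_mul (n := 4) (by norm_num) ?_
  convert add_mem (mul_mem (ofNat_mem _ 2) h1) h2 using 1
  simp only [map_add, map_sub, map_mul, map_pow, map_ofNat]
  push_cast
  ring

end Skew

/-- If a subring `R` of finite index in the maximal order of a quartic CM-field contains the
products `N(y)y/ȳ` with `y` coprime to its index, then it contains `144e` for every integer `e` on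
which complex conjugation acts as `-1`. -/
theorem mul_skew_mem (hdeg : Module.finrank ℚ K = 4) (hR : R.toAddSubgroup.index ≠ 0)
    (hT : ∀ y t : 𝓞 K, IsCoprime y (R.toAddSubgroup.index : 𝓞 K) →
      t * conjO K y = (Algebra.norm ℤ y : 𝓞 K) * y → t ∈ R)
    {e : 𝓞 K} (he : conjO K e = -e) : ((144 : ℕ) : 𝓞 K) * e ∈ R := by
  apply mem_of_forall_mem_localization
  intro p hp
  have hu := fun x hx => div_conj_mem_localization (hp := hp) hR hT (x := x) hx
  have h4 := four_mul_prime_mul_skew_mem hR hu he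
  -- `144` is a multiple of `4p` for `p = 2` and `p = 3`: it is `18 · 8` and `12 · 12`. For `p ≥ 5`
  -- no factor is needed.
  obtain rfl | h2 := eq_or_ne p 2
  · convert mul_mem (natCast_mem _ 18) h4 using 1
    simp only [map_mul, map_natCast, map_ofNat]; push_cast; ring
  obtain rfl | h3 := eq_or_ne p 3
  · convert mul_mem (natCast_mem _ 12) h4 using 1
    simp only [map_mul, map_natCast, map_ofNat]; push_cast; ring
  have h5 : 5 ≤ p := by
    have := hp.two_le
    by_contra hlt
    have h4 : p = 4 := by omega
    exact absurd hp (by rw [h4]; norm_num)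
  rw [map_mul, map_natCast]
  exact mul_mem (natCast_mem _ _) (skew_mem_of_five_le hu hdeg h5 he)

theorem index_sq_dvd_of_norm_mul_div_conj_mem (hdeg : Module.finrank ℚ K = 4)
    (hR : R.toAddSubgroup.index ≠ 0)
    (hT : ∀ y t : 𝓞 K, IsCoprime y (R.toAddSubgroup.index : 𝓞 K) →
      t * conjO K y = (Algebra.norm ℤ y : 𝓞 K) * y → t ∈ R) :
    R.toAddSubgroup.index ^ 2 ∣
      2 ^ 40 * 3 ^ 16 * Ideal.absNorm (relDiscr (maximalRealSubfield K) K) :=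
  -- Here `2⁴ · 144⁸ = 2³⁶ · 3¹⁶`, which divides the stated constant.
  (index_sq_dvd_relDiscr hdeg R 144 (by norm_num) fun _ he => mul_skew_mem hdeg hR hT he).trans
    (mul_dvd_mul_right (by norm_num) _)

end Local

/-! ### Quadratic fields and the fifth cyclotomic field. -/

section Quadratic

theorem exists_rat_add_rat_mul {F : Type*} [Field F] [NumberField F]
    (hF : Module.finrank ℚ F = 2) : ∃ r : F, (∀ q : ℚ, r ≠ q) ∧ (∃ d : ℚ, r ^ 2 = d) ∧
      ∀ x : F, ∃ a b : ℚ, x = a + b * r := by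
  obtain ⟨x, hx⟩ : ∃ x : F, ∀ q : ℚ, x ≠ q := by
    by_contra! h
    have hsurj : Function.Surjective (Algebra.linearMap ℚ F) := fun x => by
      obtain ⟨q, hq⟩ := h x
      exact ⟨q, by rw [hq]; simp⟩
    have := LinearMap.finrank_le_finrank_of_surjective hsurj
    rw [hF, Module.finrank_self] at this
    omega
  have hlin : LinearIndependent ℚ ![(1 : F), x] := by
    rw [LinearIndependent.pair_iff]
    intro s t hst
    have ht : t = 0 := by
      by_contra ht
      apply hx (-s / t)
      have ht' : (t : F) ≠ 0 := by exact_mod_cast ht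
      simp only [Rat.smul_def] at hst
      push_cast
      field_simp
      linear_combination hst
    refine ⟨?_, ht⟩
    rw [ht] at hst
    simpa using hst
  have hspan := hlin.span_eq_top_of_card_eq_finrank' (by simp [hF])
  have hx2 : ∀ y : F, ∃ a b : ℚ, y = a + b * x := by
    intro y
    have : y ∈ Submodule.span ℚ (Set.range ![(1 : F), x]) := hspan ▸ trivial
    rw [Matrix.range_cons, Matrix.range_cons, Matrix.range_empty, Set.union_empty,
      Set.singleton_union, Submodule.mem_span_pair] at this
    obtain ⟨a, b, h⟩ := this
    exact ⟨a, b, by rw [← h]; simp [Rat.smul_def]⟩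
  obtain ⟨a, b, hab⟩ := hx2 (x ^ 2)
  refine ⟨x - (b / 2 : ℚ), fun q hq => hx (q + (b / 2 : ℚ)) ?_, ⟨a + b ^ 2 / 4, ?_⟩, fun y => ?_⟩
  · push_cast at hq ⊢
    linear_combination hq
  · push_cast
    linear_combination hab
  · obtain ⟨u, v, h⟩ := hx2 y
    refine ⟨u + v * b / 2, v, ?_⟩
    push_cast
    linear_combination h

theorem nonempty_ringEquiv_cyclotomicField_five {F : Type*} [Field F] [NumberField F]
    (hdeg : Module.finrank ℚ F = 4) {η : F} (hη : IsPrimitiveRoot η 5) :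
    Nonempty (F ≃+* CyclotomicField 5 ℚ) := by
  have hirr := Polynomial.cyclotomic.irreducible_rat (n := 5) (by norm_num)
  have htop : Algebra.adjoin ℚ {η} = ⊤ := by
    have hint : IsIntegral ℚ η := Algebra.IsIntegral.isIntegral η
    rw [← IntermediateField.adjoin_simple_toSubalgebra_of_isAlgebraic hint.isAlgebraic,
      ← IntermediateField.top_toSubalgebra]
    congr 1
    apply IntermediateField.eq_of_le_of_finrank_eq le_top
    rw [IntermediateField.adjoin.finrank hint, ← hη.minpoly_eq_cyclotomic_of_irreducible hirr,
      Polynomial.natDegree_cyclotomic, IntermediateField.finrank_top', hdeg,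
      Nat.totient_prime (by norm_num)]
  have hcyc : IsCyclotomicExtension {5} ℚ F := by
    rw [IsCyclotomicExtension.iff_singleton]
    refine ⟨⟨η, hη⟩, fun x => ?_⟩
    have hx : x ∈ Algebra.adjoin ℚ {η} := by
      rw [htop]
      exact Algebra.mem_top
    refine Algebra.adjoin_mono ?_ hx
    rw [Set.singleton_subset_iff]
    exact hη.pow_eq_one
  have : Nonempty (@AlgEquiv ℚ F (CyclotomicField 5 ℚ) _ _ _ _ (CyclotomicField.algebra 5 ℚ)) :=
    ⟨IsCyclotomicExtension.algEquiv {5} ℚ F _⟩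
  exact this.map fun e => e.toRingEquiv

end Quadratic

/-! ### Consequences of not being biquadratic; units of relative norm one. -/

section Biquadratic

variable {K : Type*} [Field K] [NumberField K]

theorem isBiquadratic_of_forall_sq_eq_one (hdeg : Module.finrank ℚ K = 4) [IsGalois ℚ K]
    (h : ∀ g : K ≃ₐ[ℚ] K, g ^ 2 = 1) : IsBiquadratic K := by
  have hcard : Nat.card (K ≃ₐ[ℚ] K) = 4 := by rw [IsGalois.card_aut_eq_finrank, hdeg]
  refine ⟨inferInstance, hcard, ?_⟩
  have hd : Monoid.exponent (K ≃ₐ[ℚ] K) ∣ 2 := Monoid.exponent_dvd_of_forall_pow_eq_one h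
  rcases (Nat.dvd_prime Nat.prime_two).1 hd with h1 | h2
  · rw [Monoid.exp_eq_one_iff] at h1
    have := Nat.card_of_subsingleton (1 : K ≃ₐ[ℚ] K)
    omega
  · exact h2

/-- A quartic field generated by two square roots of rational numbers is biquadratic. -/
theorem isBiquadratic_of_sqrt (hdeg : Module.finrank ℚ K = 4) {r e : K} {d q : ℚ}
    (hr : r ^ 2 = d) (he : e ^ 2 = q) (htop : Algebra.adjoin ℚ {r, e} = ⊤) :
    IsBiquadratic K := by
  have hfac : ∀ {s : K} {t : ℚ}, s ^ 2 = t → Polynomial.map (algebraMap ℚ K)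
      (Polynomial.X ^ 2 - Polynomial.C t) =
      (Polynomial.X - Polynomial.C s) * (Polynomial.X - Polynomial.C (-s)) := by
    intro s t h
    have : (Polynomial.C (t : K)) = Polynomial.C s ^ 2 := by rw [← h, map_pow]
    simp only [Polynomial.map_sub, Polynomial.map_pow, Polynomial.map_X, Polynomial.map_C,
      eq_ratCast, this, map_neg]
    ring
  have hsplit : Polynomial.IsSplittingField ℚ K
      ((Polynomial.X ^ 2 - Polynomial.C d) * (Polynomial.X ^ 2 - Polynomial.C q)) := by
    constructor
    · rw [Polynomial.map_mul, hfac hr, hfac he]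
      exact ((Polynomial.Splits.X_sub_C _).mul (Polynomial.Splits.X_sub_C _)).mul
        ((Polynomial.Splits.X_sub_C _).mul (Polynomial.Splits.X_sub_C _))
    · rw [eq_top_iff, ← htop]
      apply Algebra.adjoin_mono
      have hne : ((Polynomial.X ^ 2 - Polynomial.C d) * (Polynomial.X ^ 2 - Polynomial.C q) :
          Polynomial ℚ) ≠ 0 :=
        mul_ne_zero (Polynomial.X_pow_sub_C_ne_zero two_pos _)
          (Polynomial.X_pow_sub_C_ne_zero two_pos _)
      rintro x (rfl | rfl)
      · rw [Polynomial.mem_rootSet]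
        exact ⟨hne, by simp [hr]⟩
      · rw [Polynomial.mem_rootSet]
        exact ⟨hne, by simp [he]⟩
  have hnormal := Normal.of_isSplittingField (F := ℚ) (E := K)
    ((Polynomial.X ^ 2 - Polynomial.C d) * (Polynomial.X ^ 2 - Polynomial.C q))
  have hgal : IsGalois ℚ K := ⟨⟩
  apply isBiquadratic_of_forall_sq_eq_one hdeg
  intro g
  have hg : ∀ {s : K} {t : ℚ}, s ^ 2 = t → g (g s) = s := by
    intro s t h
    have h1 : (g s) ^ 2 = s ^ 2 := by rw [← map_pow, h, map_ratCast]
    rcases sq_eq_sq_iff_eq_or_eq_neg.1 h1 with h | h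
    · rw [h, h]
    · rw [h, map_neg, h, neg_neg]
  have : ((g ^ 2 : K ≃ₐ[ℚ] K) : K →ₐ[ℚ] K) = AlgHom.id ℚ K := by
    apply AlgHom.ext_of_adjoin_eq_top htop
    rintro x (rfl | rfl)
    · exact hg hr
    · exact hg he
  ext x
  exact DFunLike.congr_fun this x

variable [IsCMField K]

/-- In a quartic CM-field that is not biquadratic, no square root of a rational number is purely
imaginary. -/
theorem eq_zero_of_skew_of_sq_eq_rat (hdeg : Module.finrank ℚ K = 4) (hbiq : ¬ IsBiquadratic K)
    {e : K} (he : IsCMField.complexConj K e = -e) {q : ℚ} (hq : e ^ 2 = q) : e = 0 := by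
  by_contra he0
  -- A nonzero such `e`, together with a square root `r` of a rational generating the real subfield,
  -- would generate `K`: the quotient `(x - x̄)/e` is real.
  obtain ⟨r, -, ⟨d, hd⟩, hr⟩ := exists_rat_add_rat_mul (finrank_maximalRealSubfield K hdeg)
  refine hbiq (isBiquadratic_of_sqrt hdeg (r := (r : K)) (d := d) ?_ hq ?_)
  · exact_mod_cast congrArg (Subtype.val) hd
  · rw [eq_top_iff]
    rintro x -
    have hreal : ∀ x : K, IsCMField.complexConj K x = x →
        x ∈ Algebra.adjoin ℚ {(r : K), e} := by
      intro x hx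
      rw [IsCMField.complexConj_eq_self_iff] at hx
      obtain ⟨a, b, h⟩ := hr ⟨x, hx⟩
      have h' : x = a + b * (r : K) := by
        have := congrArg (algebraMap (maximalRealSubfield K) K) h
        rw [map_add, map_mul, map_ratCast, map_ratCast] at this
        exact this
      rw [h']
      refine add_mem ?_ (mul_mem ?_ (Algebra.subset_adjoin (by simp)))
      · exact Subalgebra.algebraMap_mem _ a
      · exact Subalgebra.algebraMap_mem _ b
    have hx : x = algebraMap ℚ K (1 / 2) * (x + IsCMField.complexConj K x) +
        algebraMap ℚ K (1 / 2) * ((x - IsCMField.complexConj K x) / e * e) := by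
      rw [div_mul_cancel₀ _ he0]
      simp only [one_div, map_inv₀, map_ofNat]
      ring
    rw [hx]
    refine add_mem (mul_mem (Subalgebra.algebraMap_mem _ _) (hreal _ ?_))
      (mul_mem (Subalgebra.algebraMap_mem _ _)
        (mul_mem (hreal _ ?_) (Algebra.subset_adjoin (by simp))))
    · simp [add_comm]
    · rw [map_div₀, he, map_sub, IsCMField.complexConj_apply_apply]
      field_simp
      ring

/-- In a quartic CM-field that is neither biquadratic nor the fifth cyclotomic field, `1` and `-1`
are the only integers of relative norm one. -/
theorem eq_one_or_neg_one_of_mul_conj_eq_one (hdeg : Module.finrank ℚ K = 4)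
    (hbiq : ¬ IsBiquadratic K) (hζ : IsEmpty (K ≃+* CyclotomicField 5 ℚ)) {z : K}
    (hz : IsIntegral ℤ z) (h : z * IsCMField.complexConj K z = 1) : z = 1 ∨ z = -1 := by
  set w := IsCMField.complexConj K z with hw
  have hwz : IsCMField.complexConj K w = z := IsCMField.complexConj_apply_apply K z
  have hc : IsCMField.complexConj K (z - w) = -(z - w) := by rw [map_sub, hwz, ← hw]; ring
  -- All conjugates of `t` are real, and `(z - w)² = t² - 4` with `z - w` skew. If `z ≠ w` they lie
  -- strictly between `-2` and `2`, which leaves finitely many quadratic polynomials for `t`.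
  set t := z + w with ht
  have hct : IsCMField.complexConj K t = t := by rw [ht, map_add, hwz, ← hw]; ring
  have he2 : (z - w) ^ 2 = t ^ 2 - 4 := by linear_combination -4 * h
  suffices he : z - w = 0 by
    have hzw : z = w := sub_eq_zero.1 he
    rw [← hzw] at h
    exact mul_self_eq_one_iff.1 h
  by_cases hrat : ∃ q : ℚ, t = q
  · obtain ⟨q, hq⟩ := hrat
    exact eq_zero_of_skew_of_sq_eq_rat hdeg hbiq hc (q := q ^ 2 - 4) (by
      rw [he2, hq]; push_cast; ring)
  by_contra he
  have htint : IsIntegral ℤ t := hz.add (hz.map (IsCMField.complexConj K))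
  have htreal := (IsCMField.complexConj_eq_self_iff K t).1 hct
  obtain ⟨s, n, hsn⟩ : ∃ s n : ℤ, t ^ 2 + s * t + n = 0 := by
    have hint : IsIntegral ℤ (⟨t, htreal⟩ : maximalRealSubfield K) :=
      (isIntegral_algebraMap_iff (FaithfulSMul.algebraMap_injective _ K)).1 htint
    obtain ⟨s, n, hsn⟩ := exists_monic_quadratic (finrank_maximalRealSubfield K hdeg) ⟨_, hint⟩
    refine ⟨s, n, ?_⟩
    have := congrArg (fun x : 𝓞 (maximalRealSubfield K) =>
      algebraMap (maximalRealSubfield K) K (algebraMap (𝓞 (maximalRealSubfield K)) _ x)) hsn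
    simp only [map_add, map_intCast, map_zero] at this
    exact this
  -- the two real conjugates of `t`
  obtain ⟨φ, ψ, hφψ⟩ : ∃ φ ψ : K →+* ℂ, φ t ≠ ψ t := by
    by_contra! hall
    apply hrat
    obtain ⟨φ⟩ : Nonempty (K →+* ℂ) := inferInstance
    have hrange := Algebra.IsAlgebraic.range_eval_eq_rootSet_minpoly (F := ℚ) (K := K) ℂ t
    have hcard := Polynomial.card_rootSet_eq_natDegree (K := ℂ)
      (Algebra.IsSeparable.isSeparable ℚ t : (minpoly ℚ t).Separable) (IsAlgClosed.splits _)
    have hsub : (minpoly ℚ t).rootSet ℂ = {φ t} := by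
      rw [← hrange]
      ext x
      simp only [Set.mem_range, Set.mem_singleton_iff]
      refine ⟨fun ⟨χ, hχ⟩ => hχ ▸ hall χ.toRingHom φ, fun hx => ⟨φ.toRatAlgHom, hx.symm⟩⟩
    have hone : (minpoly ℚ t).natDegree = 1 := by
      rw [← hcard, ← Nat.card_eq_fintype_card, hsub]
      simp
    obtain ⟨q, hq⟩ := (minpoly.natDegree_eq_one_iff).1 hone
    exact ⟨q, by rw [← hq]; simp⟩
  have hbound : ∀ χ : K →+* ℂ, ∃ x : ℝ, χ t = x ∧ x ^ 2 < 4 ∧ x ^ 2 + s * x + n = 0 := by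
    intro χ
    have h1 : (starRingEnd ℂ) (χ t) = χ t := by
      rw [← IsCMField.complexEmbedding_complexConj, hct]
    obtain ⟨x, hx⟩ := Complex.conj_eq_iff_real.1 h1
    have h2 : (starRingEnd ℂ) (χ (z - w)) = -χ (z - w) := by
      rw [← IsCMField.complexEmbedding_complexConj, hc, map_neg]
    have hre : (χ (z - w)).re = 0 := by
      have := congrArg Complex.re h2
      simp only [Complex.conj_re, Complex.neg_re] at this
      linarith
    have him : (χ (z - w)).im ≠ 0 := fun h0 => he ((map_eq_zero χ).1 (Complex.ext hre h0))
    refine ⟨x, hx, ?_, ?_⟩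
    · have h3 : χ (z - w) ^ 2 = ((x ^ 2 - 4 : ℝ) : ℂ) := by
        rw [← map_pow, he2, map_sub, map_pow, hx, map_ofNat]
        push_cast
        rfl
      have h4 := congrArg Complex.re h3
      rw [sq, Complex.mul_re, hre, Complex.ofReal_re] at h4
      have := mul_self_pos.2 him
      linarith
    · have := congrArg χ hsn
      simp only [map_add, map_mul, map_pow, map_intCast, map_zero, hx] at this
      exact_mod_cast this
  obtain ⟨x, hx, hx4, hxsn⟩ := hbound φ
  obtain ⟨y, hy, hy4, hysn⟩ := hbound ψ
  have hxy : x ≠ y := fun h0 => hφψ (by rw [hx, hy, h0])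
  have hsum : x + y = -s := by
    apply mul_left_cancel₀ (sub_ne_zero.2 hxy)
    linear_combination hxsn - hysn
  have hprod : x * y = n := by linear_combination x * hsum - hxsn
  have hdisc : 4 * n < s ^ 2 := by
    have : (0 : ℝ) < (x - y) ^ 2 := by have := sub_ne_zero.2 hxy; positivity
    have h2 : (4 * n : ℝ) < s ^ 2 := by nlinarith
    exact_mod_cast h2
  obtain ⟨hx1, hx2⟩ := abs_lt.1 (abs_lt_of_sq_lt_sq (by linarith : x ^ 2 < 2 ^ 2) (by norm_num))
  obtain ⟨hy1, hy2⟩ := abs_lt.1 (abs_lt_of_sq_lt_sq (by linarith : y ^ 2 < 2 ^ 2) (by norm_num))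
  have hs1 : -4 < s := by
    have : (-4 : ℝ) < s := by linarith
    exact_mod_cast this
  have hs2 : s < 4 := by
    have : (s : ℝ) < 4 := by linarith
    exact_mod_cast this
  -- These two quantities are `(2 - x)(2 - y)` and `(2 + x)(2 + y)`.
  have hn1 : 0 < 4 + 2 * s + n := by
    have : (0 : ℝ) < 4 + 2 * s + n := by nlinarith
    exact_mod_cast this
  have hn2 : 0 < 4 - 2 * s + n := by
    have : (0 : ℝ) < 4 - 2 * s + n := by nlinarith
    exact_mod_cast this
  have ht0 : ∀ q : ℚ, t ≠ q := fun q hq => hrat ⟨q, hq⟩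
  by_cases hs0 : s = 0
  -- If `t² = -n`, the skew element `(z - w)t` has rational square `t²(t² - 4) = n(n + 4)`.
  · have : (z - w) * t = 0 := by
      refine eq_zero_of_skew_of_sq_eq_rat hdeg hbiq (q := n * (n + 4)) ?_ ?_
      · rw [map_mul, hc, hct]; ring
      · rw [hs0] at hsn
        push_cast at hsn ⊢
        rw [mul_pow, he2]
        linear_combination (t ^ 2 - 4 - n) * hsn
    exact (mul_eq_zero.1 this).elim he fun h0 => ht0 0 (by simpa using h0)
  -- For `|s| = 2` or `3` the bounds `n > 2|s| - 4` and `4n < s²` are incompatible; for `|s| = 1`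
  -- they leave `n = 0`, where `t` is rational, and `n = -1`.
  have hs : s = 1 ∨ s = -1 := by
    have : s ^ 2 < 16 := by nlinarith
    interval_cases s <;> omega
  have hs2 : (s : K) ^ 2 = 1 := by rcases hs with rfl | rfl <;> simp
  have hn : n = 0 ∨ n = -1 := by rcases hs with rfl | rfl <;> omega
  rcases hn with rfl | rfl
  · have : t * (t + s) = 0 := by push_cast at hsn; linear_combination hsn
    rcases mul_eq_zero.1 this with h0 | h0
    · exact ht0 0 (by simpa using h0)
    · exact ht0 (-s) (by push_cast; linear_combination h0)
  -- now `s * z` is a primitive fifth root of unity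
  set η := s * z with hη
  have hη4 : η ^ 4 + η ^ 3 + η ^ 2 + η + 1 = 0 := by
    push_cast at hsn
    have h1 : z ^ 4 + s * z ^ 3 + z ^ 2 + s * z + 1 = 0 := by
      rw [ht] at hsn
      linear_combination z ^ 2 * hsn - (2 * z ^ 2 + z * w + 1 + s * z) * h
    have : η ^ 4 + η ^ 3 + η ^ 2 + η + 1 = z ^ 4 + s * z ^ 3 + z ^ 2 + s * z + 1 := by
      rw [hη]
      linear_combination (z ^ 4 * (s ^ 2 + 1) + z ^ 3 * s + z ^ 2) * hs2
    rw [this, h1]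
  have hη5 : η ^ 5 = 1 := by linear_combination (η - 1) * hη4
  have hη1 : η ≠ 1 := by
    intro h1
    rw [h1] at hη4
    norm_num at hη4
  have hprim : IsPrimitiveRoot η 5 := by
    have : Fact (Nat.Prime 5) := ⟨by norm_num⟩
    have ho := orderOf_eq_prime hη5 hη1
    exact ho ▸ IsPrimitiveRoot.orderOf η
  exact (nonempty_ringEquiv_cyclotomicField_five hdeg hprim).elim hζ.elim

end Biquadratic

/-! ### CM-types of a quartic CM-field. -/

section CMTypes

variable {K : Type*} [Field K] [NumberField K] [IsCMField K]

theorem conjugate_apply (φ : K →+* ℂ) (y : K) :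
    ComplexEmbedding.conjugate φ y = φ (IsCMField.complexConj K y) := by
  rw [IsCMField.complexEmbedding_complexConj, ComplexEmbedding.conjugate_coe_eq]

variable (K) in
theorem exists_skew_ne_zero' : ∃ e : K, IsCMField.complexConj K e = -e ∧ e ≠ 0 := by
  obtain ⟨e, he, he0⟩ := exists_skew_ne_zero (K := K)
  refine ⟨algebraMap (𝓞 K) K e, ?_, ?_⟩
  · rw [← algebraMap_conj, he, map_neg]
  · exact (map_ne_zero_iff _ (FaithfulSMul.algebraMap_injective (𝓞 K) K)).2 he0

theorem conjugate_ne_self (φ : K →+* ℂ) : ComplexEmbedding.conjugate φ ≠ φ := by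
  intro h
  obtain ⟨e, he, he0⟩ := exists_skew_ne_zero' K
  have := DFunLike.congr_fun h e
  rw [conjugate_apply, he, map_neg, neg_eq_self] at this
  exact he0 ((map_eq_zero φ).1 this)

/-- A CM-type of a quartic CM-field consists of two embeddings that are not conjugate. -/
theorem IsCMType.exists_pair (hdeg : Module.finrank ℚ K = 4) {Φ : Finset (K →+* ℂ)}
    (hΦ : IsCMType Φ) : ∃ α β : K →+* ℂ, α ≠ β ∧ β ≠ ComplexEmbedding.conjugate α ∧
      (∀ φ, φ ∈ Φ ↔ φ = α ∨ φ = β) ∧ (∀ y, ∏ φ ∈ Φ, φ y = α y * β y) ∧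
      ∀ φ, φ = α ∨ φ = β ∨ φ = ComplexEmbedding.conjugate α ∨
        φ = ComplexEmbedding.conjugate β := by
  classical
  have hinv : Function.Involutive (ComplexEmbedding.conjugate : (K →+* ℂ) → (K →+* ℂ)) :=
    fun φ => star_involutive φ
  have hcompl : Φᶜ = Φ.image ComplexEmbedding.conjugate := by
    ext φ
    simp only [Finset.mem_compl, Finset.mem_image]
    constructor
    · intro h
      rcases hΦ φ with h' | h'
      · exact absurd h'.1 h
      · exact ⟨_, h'.1, hinv φ⟩
    · rintro ⟨ψ, hψ, rfl⟩
      rcases hΦ ψ with h' | h'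
      · exact h'.2
      · exact absurd hψ h'.2
  have hcard : Φ.card = 2 := by
    have h1 := Finset.card_add_card_compl Φ
    rw [hcompl, Finset.card_image_of_injective _ hinv.injective, Embeddings.card, hdeg] at h1
    omega
  obtain ⟨α, β, hαβ, hpair⟩ := Finset.card_eq_two.1 hcard
  have hmem : ∀ φ, φ ∈ Φ ↔ φ = α ∨ φ = β := fun φ => by rw [hpair]; simp
  refine ⟨α, β, hαβ, ?_, hmem, fun y => ?_, fun φ => ?_⟩
  · rintro h
    have hα : α ∈ Φ := (hmem α).2 (Or.inl rfl)
    have hβ : ComplexEmbedding.conjugate α ∈ Φ := (hmem _).2 (Or.inr h.symm)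
    rcases hΦ α with h' | h'
    · exact h'.2 hβ
    · exact h'.2 hα
  · rw [hpair, Finset.prod_pair hαβ]
  · rcases hΦ φ with h' | h'
    · exact ((hmem φ).1 h'.1).elim Or.inl fun h => Or.inr (Or.inl h)
    · rcases (hmem _).1 h'.1 with h | h
      · exact Or.inr (Or.inr (Or.inl (by rw [← h, hinv])))
      · exact Or.inr (Or.inr (Or.inr (by rw [← h, hinv])))

/-- The product of two embeddings that are neither equal nor conjugate is not real-valued. -/
theorem exists_mul_ne_conjugate_mul {α β : K →+* ℂ} (hβ : β ≠ ComplexEmbedding.conjugate α) :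
    ∃ y, α y * β y ≠ ComplexEmbedding.conjugate α y * ComplexEmbedding.conjugate β y := by
  by_contra! h
  simp only [conjugate_apply] at h
  have h1 : ∀ e, IsCMField.complexConj K e = -e → α e = -β e := by
    intro e he
    -- Evaluating at `1 + e` isolates the part linear in `e`, giving `α(e) = -β(e)`. Multiplying `e`
    -- by a real element then shows that `α` and `β` agree on real elements.
    have := h (1 + e)
    simp only [map_add, map_one, he, map_neg] at this
    linear_combination this / 2
  obtain ⟨e, he, he0⟩ := exists_skew_ne_zero' K
  have h2 : ∀ a, IsCMField.complexConj K a = a → α a = β a := by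
    intro a ha
    have h3 := h1 (a * e) (by rw [map_mul, ha, he]; ring)
    rw [map_mul, map_mul, h1 e he] at h3
    have : β e ≠ 0 := (map_ne_zero β).2 he0
    apply mul_right_cancel₀ this
    linear_combination -h3
  apply hβ
  ext y
  rw [conjugate_apply]
  have h3 := h1 (y - IsCMField.complexConj K y) (by
    rw [map_sub, IsCMField.complexConj_apply_apply]; ring)
  have h4 := h2 (y + IsCMField.complexConj K y) (by
    rw [map_add, IsCMField.complexConj_apply_apply]; ring)
  simp only [map_add, map_sub] at h3 h4
  linear_combination (h3 - h4) / 2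

end CMTypes

/-! ### Embeddings of number fields into normal fields. -/

section NormalClosure

/-- Two embeddings of a normal number field into `ℂ` differ by an automorphism. -/
theorem exists_eq_comp_of_normal {L : Type*} [Field L] [NumberField L] [Normal ℚ L]
    (ψ χ : L →+* ℂ) : ∃ g : L ≃ₐ[ℚ] L, ∀ x, χ x = ψ (g x) := by
  let := ψ.toAlgebra
  have : IsScalarTower ℚ L ℂ := inferInstance
  refine ⟨AlgHom.restrictNormal' χ.toRatAlgHom L, fun x => ?_⟩
  exact (AlgHom.restrictNormal_commutes χ.toRatAlgHom L x).symm

theorem exists_extension {F L : Type*} [Field F] [NumberField F] [Field L] [NumberField L]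
    (i : F →+* L) (φ : F →+* ℂ) : ∃ ψ : L →+* ℂ, ∀ x, ψ (i x) = φ x := by
  let := i.toAlgebra
  let := φ.toAlgebra
  have : IsScalarTower ℚ F L := inferInstance
  have : Algebra.IsAlgebraic F L := Algebra.IsAlgebraic.tower_top (K := ℚ) F
  exact ⟨(IsAlgClosed.lift : L →ₐ[F] ℂ), fun x => (IsAlgClosed.lift : L →ₐ[F] ℂ).commutes x⟩

/-- An extension of `φ` to `L` differs from `ψ` by an automorphism of `L`. This moves computations
with complex embeddings into `L`. -/
theorem exists_factor_of_normal {F L : Type*} [Field F] [NumberField F] [Field L] [NumberField L]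
    [Normal ℚ L] (i : F →+* L) (ψ : L →+* ℂ) (φ : F →+* ℂ) :
    ∃ κ : F →+* L, ∀ x, ψ (κ x) = φ x := by
  obtain ⟨χ, hχ⟩ := exists_extension i φ
  obtain ⟨g, hg⟩ := exists_eq_comp_of_normal ψ χ
  exact ⟨(g : L →+* L).comp i, fun x => by rw [← hχ, hg]; rfl⟩

theorem norm_eq_prod_ringHom {F : Type*} [Field F] [NumberField F] (x : F) :
    ((Algebra.norm ℚ x : ℚ) : ℂ) = ∏ φ : F →+* ℂ, φ x := by
  have := Algebra.norm_eq_prod_embeddings ℚ ℂ x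
  rw [eq_ratCast] at this
  rw [this]
  exact Fintype.prod_equiv (RingHom.equivRatAlgHom F ℂ).symm _ _ fun _ => rfl

end NormalClosure

/-! ### The type norm and embeddings of the reflex field. -/

section TypeNorm

variable {K : Type*} [Field K] [NumberField K] (Φ : Finset (K →+* ℂ))

/-- The type norm `x ↦ ∏_{φ ∈ Φ} φ(x)` from `K` to the reflex field. -/
def typeNorm : K →* reflexField Φ where
  toFun x := ⟨∏ φ ∈ Φ, φ x, IntermediateField.subset_adjoin _ _ ⟨x, rfl⟩⟩
  map_one' := by ext; simp
  map_mul' x y := by ext; simp [Finset.prod_mul_distrib]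

variable {Φ}

theorem coe_typeNorm (x : K) : (typeNorm Φ x : ℂ) = ∏ φ ∈ Φ, φ x := rfl

/-- Type norms generate the reflex field, so its embeddings can be identified and told apart on
them. -/
theorem reflexField_hom_ext {L : Type*} [Field L] [CharZero L] {σ τ : reflexField Φ →+* L}
    (h : ∀ x, σ (typeNorm Φ x) = τ (typeNorm Φ x)) : σ = τ := by
  have : σ.toRatAlgHom = τ.toRatAlgHom := by
    refine IntermediateField.algHom_ext_of_eq_adjoin ℚ (S := reflexField Φ) rfl ?_
    rintro _ ⟨x, rfl⟩
    exact h x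
  ext x
  exact DFunLike.congr_fun this x

/-- For an embedding of the normal closure, the inclusion of the reflex field factors through it. -/
theorem exists_reflexField_hom {L : Type*} [Field L] [NumberField L] [Normal ℚ L] (i : K →+* L)
    (ψ : L →+* ℂ) : ∃ τ : reflexField Φ →+* L, ∀ y, ψ (τ y) = y := by
  have hle : reflexField Φ ≤ ψ.toRatAlgHom.fieldRange := by
    rw [reflexField, IntermediateField.adjoin_le_iff]
    rintro _ ⟨x, rfl⟩
    refine prod_mem fun φ _ => ?_
    obtain ⟨κ, hκ⟩ := exists_factor_of_normal i ψ φ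
    exact ⟨κ x, hκ x⟩
  let e := AlgEquiv.ofInjectiveField ψ.toRatAlgHom
  refine ⟨(e.symm.toAlgHom.comp (IntermediateField.inclusion hle)).toRingHom, fun y => ?_⟩
  have := AlgEquiv.apply_symm_apply e (IntermediateField.inclusion hle y)
  exact congrArg Subtype.val this

end TypeNorm

/-! ### The type norm composed with the reflex type norm and the rational norm. -/

section ReflexNorm

variable {K : Type*} [Field K] [NumberField K] [IsCMField K]

local notation "conjK" => IsCMField.complexConj K

theorem conjugate_conj (φ : K →+* ℂ) (y : K) :
    ComplexEmbedding.conjugate φ (conjK y) = φ y := by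
  rw [conjugate_apply, IsCMField.complexConj_apply_apply]

/-- The rational norm on a quartic CM-field in terms of two non-conjugate embeddings. -/
theorem norm_eq_of_pair {α β : K →+* ℂ} (hαβ : α ≠ β) (hβ : β ≠ ComplexEmbedding.conjugate α)
    (hall : ∀ φ, φ = α ∨ φ = β ∨ φ = ComplexEmbedding.conjugate α ∨
        φ = ComplexEmbedding.conjugate β) (y : K) :
    ((Algebra.norm ℚ y : ℚ) : ℂ) = α y * α (conjK y) * β y * β (conjK y) := by
  classical
  have hinv : Function.Involutive (ComplexEmbedding.conjugate : (K →+* ℂ) → (K →+* ℂ)) :=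
    fun φ => star_involutive φ
  have huniv : (Finset.univ : Finset (K →+* ℂ)) =
      {α, β, ComplexEmbedding.conjugate α, ComplexEmbedding.conjugate β} := by
    ext φ
    simpa using hall φ
  rw [norm_eq_prod_ringHom, huniv, Finset.prod_insert, Finset.prod_insert, Finset.prod_pair]
  · rw [conjugate_apply, conjugate_apply]; ring
  · exact fun h => hαβ (hinv.injective h)
  · simp only [Finset.mem_insert, Finset.mem_singleton, not_or]
    exact ⟨hβ, fun h => conjugate_ne_self β h.symm⟩
  · simp only [Finset.mem_insert, Finset.mem_singleton, not_or]
    exact ⟨hαβ, fun h => conjugate_ne_self α h.symm, fun h => hβ (by rw [h, hinv])⟩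

variable {L : Type*} [Field L] [NumberField L]

theorem conj_comm_hom (k : K →+* K) (y : K) : k (conjK y) = conjK (k y) := by
  obtain ⟨φ⟩ : Nonempty (K →+* ℂ) := inferInstance
  apply φ.injective
  rw [IsCMField.complexEmbedding_complexConj]
  exact IsCMField.complexEmbedding_complexConj K (φ.comp k) y

/-- The embeddings of a quartic CM-field in a normal field, given two that are not conjugate. -/
theorem hom_eq_of_pair {i κ : K →+* L} {ψ : L →+* ℂ} {α β : K →+* ℂ} (hi : ∀ x, ψ (i x) = α x)
    (hκ : ∀ x, ψ (κ x) = β x)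
    (hall : ∀ φ, φ = α ∨ φ = β ∨ φ = ComplexEmbedding.conjugate α ∨
        φ = ComplexEmbedding.conjugate β) (l : K →+* L) :
    (∀ x, l x = i x) ∨ (∀ x, l x = κ x) ∨ (∀ x, l x = i (conjK x)) ∨
      (∀ x, l x = κ (conjK x)) := by
  rcases hall (ψ.comp l) with h | h | h | h
  · exact Or.inl fun x => ψ.injective (by rw [hi, ← h]; rfl)
  · exact Or.inr (Or.inl fun x => ψ.injective (by rw [hκ, ← h]; rfl))
  · exact Or.inr (Or.inr (Or.inl fun x => ψ.injective (by rw [hi, ← conjugate_apply, ← h]; rfl)))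
  · exact Or.inr (Or.inr (Or.inr fun x => ψ.injective (by rw [hκ, ← conjugate_apply, ← h]; rfl)))

/-- A quartic CM-field is biquadratic if it has an involution other than complex conjugation that
generates its automorphisms together with complex conjugation. -/
theorem isBiquadratic_of_involution (hdeg : Module.finrank ℚ K = 4) {k : K →+* K}
    (hk1 : k ≠ RingHom.id K) (hkc : ∃ x, k x ≠ conjK x) (hk2 : ∀ x, k (k x) = x)
    (hall : ∀ l : K →+* K, (∀ x, l x = x) ∨ (∀ x, l x = k x) ∨ (∀ x, l x = conjK x) ∨
      (∀ x, l x = k (conjK x))) : IsBiquadratic K := by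
  classical
  have hc1 : ∃ x : K, conjK x ≠ x := by
    obtain ⟨e, he, he0⟩ := exists_skew_ne_zero' K
    exact ⟨e, fun h => he0 (by rw [he, neg_eq_self] at h; exact h)⟩
  let g : K ≃ₐ[ℚ] K := AlgEquiv.ofAlgHom k.toRatAlgHom k.toRatAlgHom (AlgHom.ext hk2)
    (AlgHom.ext hk2)
  let c : K ≃ₐ[ℚ] K := (IsCMField.complexConj K).restrictScalars ℚ
  have hg : ∀ x, g x = k x := fun x => rfl
  have hc : ∀ x, c x = conjK x := fun x => rfl
  have h1g : (1 : K ≃ₐ[ℚ] K) ≠ g := fun h => hk1 (RingHom.ext fun x => (DFunLike.congr_fun h x).symm)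
  have h1c : (1 : K ≃ₐ[ℚ] K) ≠ c := fun h => hc1.elim fun x hx => hx (DFunLike.congr_fun h x).symm
  have hgc : g ≠ c := fun h => hkc.elim fun x hx => hx (DFunLike.congr_fun h x)
  have hcard : ({1, g, c, g * c} : Finset (K ≃ₐ[ℚ] K)).card = 4 := by
    rw [Finset.card_insert_of_notMem, Finset.card_insert_of_notMem, Finset.card_pair]
    · intro h
      exact h1g (mul_right_cancel (b := c) (by rw [one_mul]; exact h))
    · simp only [Finset.mem_insert, Finset.mem_singleton, not_or]
      refine ⟨hgc, fun h => h1c (mul_left_cancel (a := g) ?_)⟩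
      rw [mul_one]; exact h
    · simp only [Finset.mem_insert, Finset.mem_singleton, not_or]
      refine ⟨h1g, h1c, fun h => hkc.elim fun x hx => hx ?_⟩
      have := DFunLike.congr_fun h x
      have h2 : x = k (conjK x) := this
      rw [h2, hk2, ← h2]
  have hgal : IsGalois ℚ K := by
    apply IsGalois.of_card_aut_eq_finrank
    apply le_antisymm
    · rw [Nat.card_eq_fintype_card]
      exact AlgEquiv.card_le
    · rw [hdeg, ← hcard, Nat.card_eq_fintype_card]
      exact Finset.card_le_univ _
  apply isBiquadratic_of_forall_sq_eq_one hdeg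
  intro a
  ext x
  change a (a x) = x
  rcases hall (a : K →+* K) with h | h | h | h
  · have h' : ∀ x, a x = x := h
    rw [h', h']
  · have h' : ∀ x, a x = k x := h
    rw [h', h', hk2]
  · have h' : ∀ x, a x = conjK x := h
    rw [h', h', IsCMField.complexConj_apply_apply]
  · have h' : ∀ x, a x = k (conjK x) := h
    rw [h', h', ← conj_comm_hom, hk2, IsCMField.complexConj_apply_apply]

/-- In the normal closure `L` of a quartic CM-field that is not biquadratic, some automorphism
exchanges the two conjugate pairs of CM-types. -/
theorem exists_aut_of_not_isBiquadratic (hdeg : Module.finrank ℚ K = 4)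
    (hbiq : ¬ IsBiquadratic K) [Algebra K L] [Normal ℚ L] {κ : K →+* L}
    (hκi : ∃ x, κ x ≠ algebraMap K L x) (hκc : ∃ x, κ x ≠ algebraMap K L (conjK x))
    (hall : ∀ l : K →+* L, (∀ x, l x = algebraMap K L x) ∨ (∀ x, l x = κ x) ∨
      (∀ x, l x = algebraMap K L (conjK x)) ∨ (∀ x, l x = κ (conjK x))) :
    ∃ g : L →+* L, ((∀ x, g (algebraMap K L x) = algebraMap K L x) ∧ ∀ x, g (κ x) = κ (conjK x)) ∨
      ((∀ x, g (algebraMap K L x) = κ x) ∧ ∀ x, g (κ x) = algebraMap K L (conjK x)) := by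
  by_cases hrange : ∀ x, κ x ∈ Set.range (algebraMap K L)
  · -- `K` is Galois over `ℚ`
    have hinj := (algebraMap K L).injective
    have hrange' : κ.range ≤ (algebraMap K L).range := by
      rintro _ ⟨x, rfl⟩
      exact hrange x
    obtain ⟨k, hk⟩ : ∃ k : K →+* K, ∀ x, algebraMap K L (k x) = κ x := by
      choose f hf using hrange
      exact ⟨{ toFun := f
               map_one' := hinj (by rw [hf, map_one, map_one])
               map_mul' := fun x y => hinj (by rw [hf, map_mul, map_mul, hf, hf])
               map_zero' := hinj (by rw [hf, map_zero, map_zero])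
               map_add' := fun x y => hinj (by rw [hf, map_add, map_add, hf, hf]) }, hf⟩
    have hbij : Function.Bijective k.toRatAlgHom := Algebra.IsAlgebraic.algHom_bijective _
    obtain ⟨g, hg⟩ : ∃ g : L →+* L, ∀ x, g (algebraMap K L x) = κ x := by
      refine ⟨(AlgEquiv.liftNormal (AlgEquiv.ofBijective k.toRatAlgHom hbij) L : L →+* L),
        fun x => ?_⟩
      rw [← hk]
      exact AlgEquiv.liftNormal_commutes (AlgEquiv.ofBijective k.toRatAlgHom hbij) L x
    refine ⟨g, Or.inr ⟨hg, fun x => ?_⟩⟩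
    rw [← hk, hg, ← hk]
    congr 1
    have hallK : ∀ l : K →+* K, (∀ x, l x = x) ∨ (∀ x, l x = k x) ∨ (∀ x, l x = conjK x) ∨
        (∀ x, l x = k (conjK x)) := by
      intro l
      rcases hall ((algebraMap K L).comp l) with h | h | h | h
      · exact Or.inl fun x => hinj (h x)
      · exact Or.inr (Or.inl fun x => hinj ((h x).trans (hk x).symm))
      · exact Or.inr (Or.inr (Or.inl fun x => hinj (h x)))
      · exact Or.inr (Or.inr (Or.inr fun x => hinj ((h x).trans (hk _).symm)))
    -- `k² = 1` would make `K` biquadratic, and `k² = k` or `k²` equal to `k` after conjugation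
    -- would make `k` trivial or the conjugation. So `k²` is complex conjugation: the cyclic case.
    rcases hallK (k.comp k) with h | h | h | h
    · exfalso
      refine hbiq (isBiquadratic_of_involution hdeg ?_ ?_ h hallK)
      · rintro rfl
        exact hκi.elim fun x hx => hx (hk x).symm
      · obtain ⟨x, hx⟩ := hκc
        exact ⟨x, fun hx' => hx (by rw [← hk, hx'])⟩
    · exfalso
      obtain ⟨x, hx⟩ := hκi
      apply hx
      rw [← hk, show k x = x from k.injective (h x)]
    · exact h x
    · exfalso
      obtain ⟨x, hx⟩ := hκc
      apply hx
      rw [← hk, show k x = conjK x from k.injective (h x)]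
  · -- `K` is not Galois over `ℚ`
    push Not at hrange
    obtain ⟨x₀, hx₀⟩ := hrange
    have hgal : IsGalois ℚ L := ⟨⟩
    have hgal' : IsGalois K L := IsGalois.tower_top_of_isGalois ℚ K L
    have hfin : FiniteDimensional K L := FiniteDimensional.right ℚ K L
    rw [IsGalois.mem_range_algebraMap_iff_fixed] at hx₀
    push Not at hx₀
    -- `g` fixes `K` but moves a value of `κ`. Since `gκ` cannot be an embedding with image in `K`,
    -- only `κ` composed with conjugation remains.
    obtain ⟨g, hg⟩ := hx₀
    refine ⟨(g : L →+* L), Or.inl ⟨fun x => g.commutes x, ?_⟩⟩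
    have hg' : ∀ x, g.symm (algebraMap K L x) = algebraMap K L x := fun x => g.symm.commutes x
    rcases hall ((g : L →+* L).comp κ) with h | h | h | h
    · exfalso
      obtain ⟨x, hx⟩ := hκi
      apply hx
      have : g (κ x) = algebraMap K L x := h x
      rw [← hg' x, ← this, AlgEquiv.symm_apply_apply]
    · exact absurd (h x₀) hg
    · exfalso
      obtain ⟨x, hx⟩ := hκc
      apply hx
      have : g (κ x) = algebraMap K L (conjK x) := h x
      rw [← hg' (conjK x), ← this, AlgEquiv.symm_apply_apply]
    · exact h

variable (L) in
/-- The type norm followed by the reflex type norm, and by the rational norm of the reflex field,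
for a quartic CM-field that is not biquadratic. -/
theorem exists_reflex_norms (hdeg : Module.finrank ℚ K = 4)
    (hbiq : ¬ IsBiquadratic K) [Algebra K L] [IsNormalClosure ℚ K L] {Φ : Finset (K →+* ℂ)}
    (hΦ : IsCMType Φ) : ∃ κ : K →+* L,
      (∀ y, ((Algebra.norm ℚ y : ℚ) : L) =
        algebraMap K L y * algebraMap K L (conjK y) * κ y * κ (conjK y)) ∧
      (∀ y, ∏ τ ∈ reflexType Φ L, τ (typeNorm Φ y) =
        algebraMap K L y * κ y * (algebraMap K L y * κ (conjK y))) ∧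
      ∀ y, Algebra.norm ℚ (typeNorm Φ y) = (Algebra.norm ℚ y) ^ 2 := by
  classical
  have hnormal : Normal ℚ L := IsNormalClosure.normal (K := K)
  obtain ⟨α, β, hαβ, hβ, hmem, hprod, hall⟩ := hΦ.exists_pair hdeg
  obtain ⟨ψ, hψ⟩ := exists_extension (algebraMap K L) α
  obtain ⟨κ, hκ⟩ := exists_factor_of_normal (algebraMap K L) ψ β
  have hhom := hom_eq_of_pair hψ hκ hall
  have hκi : ∃ x, κ x ≠ algebraMap K L x := by
    by_contra! h
    exact hαβ (RingHom.ext fun x => by rw [← hψ, ← hκ, h])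
  have hκc : ∃ x, κ x ≠ algebraMap K L (conjK x) := by
    by_contra! h
    exact hβ (RingHom.ext fun x => by rw [conjugate_apply, ← hψ, ← hκ, h])
  have hκκ : ∃ x, κ x ≠ κ (conjK x) := by
    by_contra! h
    exact conjugate_ne_self β (RingHom.ext fun x => by rw [conjugate_apply, ← hκ, ← h, hκ])
  obtain ⟨g, hg⟩ := exists_aut_of_not_isBiquadratic hdeg hbiq hκi hκc hhom
  have hz : ∀ y, ((typeNorm Φ y : reflexField Φ) : ℂ) = α y * β y := fun y => by
    rw [coe_typeNorm, hprod]
  -- the two elements of the reflex type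
  obtain ⟨τ₁, hτ₁⟩ := exists_reflexField_hom (Φ := Φ) (algebraMap K L) ψ
  -- The second element of the reflex type comes from the embedding `ψ ∘ g`: whichever form `g` has,
  -- this restricts to an element of `Φ`.
  obtain ⟨τ₂, hτ₂⟩ := exists_reflexField_hom (Φ := Φ) (algebraMap K L) (ψ.comp g)
  have hτ₁z : ∀ y, τ₁ (typeNorm Φ y) = algebraMap K L y * κ y := fun y =>
    ψ.injective (by rw [hτ₁, hz, map_mul, hψ, hκ])
  have hτ₂z : ∀ y, τ₂ (typeNorm Φ y) = algebraMap K L y * κ (conjK y) := fun y =>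
    (ψ.comp g).injective (by
      rw [hτ₂, hz, map_mul, RingHom.comp_apply, RingHom.comp_apply]
      rcases hg with ⟨h1, h2⟩ | ⟨h1, h2⟩
      · rw [h1, h2, hψ, hκ, IsCMField.complexConj_apply_apply]
      · rw [h1, h2, hψ, hκ, IsCMField.complexConj_apply_apply, mul_comm])
  have hτne : τ₁ ≠ τ₂ := by
    intro h
    obtain ⟨x, hx⟩ := hκκ
    have h1 := hτ₁z x
    rw [h, hτ₂z] at h1
    have hx0 : algebraMap K L x ≠ 0 := by
      rw [ne_eq, map_eq_zero]
      rintro rfl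
      simp at hx
    exact hx (mul_left_cancel₀ hx0 h1).symm
  have hmem_iff : ∀ τ, τ ∈ reflexType Φ L ↔ ∃ χ : L →+* ℂ, χ.comp (algebraMap K L) ∈ Φ ∧
      ∀ y : reflexField Φ, χ (τ y) = y := fun τ => Set.Finite.mem_toFinset _
  have hreflex : reflexType Φ L = {τ₁, τ₂} := by
    ext τ
    rw [hmem_iff, Finset.mem_insert, Finset.mem_singleton]
    constructor
    · rintro ⟨χ, hχ, hτ⟩
      -- `γ` is the element of `Φ` other than the restriction of `χ`; pulled back along `χ` it must
      -- be `κ` or `κ` after conjugation.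
      obtain ⟨γ, hγα, hγc, hγ⟩ : ∃ γ : K →+* ℂ, γ ≠ χ.comp (algebraMap K L) ∧
          γ ≠ ComplexEmbedding.conjugate (χ.comp (algebraMap K L)) ∧
          ∀ y, α y * β y = χ (algebraMap K L y) * γ y := by
        rcases (hmem _).1 hχ with h | h
        · exact ⟨β, by rw [h]; exact hαβ.symm, by rw [h]; exact hβ, fun y => by rw [← h]; rfl⟩
        · refine ⟨α, by rw [h]; exact hαβ, ?_, fun y => by rw [mul_comm, ← h]; rfl⟩
          rw [h]
          rintro h'
          exact hβ (by rw [h']; exact (star_involutive β).symm)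
      obtain ⟨l, hl⟩ := exists_factor_of_normal (algebraMap K L) χ γ
      have hτz : ∀ y, τ (typeNorm Φ y) = algebraMap K L y * l y := fun y =>
        χ.injective (by rw [hτ, hz, map_mul, hl, hγ])
      rcases hhom l with h | h | h | h
      · exact absurd (RingHom.ext fun x => by rw [← hl, h]; rfl) hγα
      · exact Or.inl (reflexField_hom_ext fun y => by rw [hτz, hτ₁z, h])
      · exact absurd (RingHom.ext fun x => by rw [← hl, h, conjugate_apply]; rfl) hγc
      · exact Or.inr (reflexField_hom_ext fun y => by rw [hτz, hτ₂z, h])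
    · rintro (rfl | rfl)
      · exact ⟨ψ, (hmem _).2 (Or.inl (RingHom.ext hψ)), hτ₁⟩
      · refine ⟨ψ.comp g, (hmem _).2 ?_, hτ₂⟩
        rcases hg with ⟨h1, h2⟩ | ⟨h1, h2⟩
        · exact Or.inl (RingHom.ext fun x => by
            rw [RingHom.comp_apply, RingHom.comp_apply, h1, hψ])
        · exact Or.inr (RingHom.ext fun x => by
            rw [RingHom.comp_apply, RingHom.comp_apply, h1, hκ])
  have hnorm := norm_eq_of_pair hαβ hβ hall
  refine ⟨κ, fun y => ψ.injective ?_, fun y => ?_, fun y => ?_⟩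
  · rw [map_ratCast, hnorm]
    simp only [map_mul, hψ, hκ]
  · rw [hreflex, Finset.prod_pair hτne, hτ₁z, hτ₂z]
  -- the four embeddings of the reflex field
  let ρ₁ : reflexField Φ →+* ℂ := ψ.comp τ₁
  let ρ₂ : reflexField Φ →+* ℂ := ψ.comp τ₂
  let ρ₃ : reflexField Φ →+* ℂ := ComplexEmbedding.conjugate ρ₁
  let ρ₄ : reflexField Φ →+* ℂ := ComplexEmbedding.conjugate ρ₂
  have hinv : Function.Involutive
      (ComplexEmbedding.conjugate : (reflexField Φ →+* ℂ) → (reflexField Φ →+* ℂ)) :=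
    fun φ => star_involutive φ
  have h1 : ∀ y, ρ₁ (typeNorm Φ y) = α y * β y := fun y => hτ₁ _ |>.trans (hz y)
  have h2 : ∀ y, ρ₂ (typeNorm Φ y) = α y * β (conjK y) := fun y => by
    change ψ _ = _
    rw [hτ₂z, map_mul, hψ, hκ]
  have h3 : ∀ y, ρ₃ (typeNorm Φ y) = α (conjK y) * β (conjK y) := fun y => by
    change (starRingEnd ℂ) (ρ₁ _) = _
    rw [h1, map_mul, IsCMField.complexEmbedding_complexConj, IsCMField.complexEmbedding_complexConj]
  have h4 : ∀ y, ρ₄ (typeNorm Φ y) = α (conjK y) * β y := fun y => by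
    change (starRingEnd ℂ) (ρ₂ _) = _
    rw [h2, map_mul, IsCMField.complexEmbedding_complexConj,
      IsCMField.complexEmbedding_complexConj, Complex.conj_conj]
  have hcancel : ∀ γ δ : K →+* ℂ, (∀ y, γ y * δ y = ComplexEmbedding.conjugate γ y * δ y) →
      False := by
    intro γ δ h
    apply conjugate_ne_self γ
    ext x
    by_cases hx : x = 0
    · simp [hx]
    · exact (mul_right_cancel₀ ((map_ne_zero δ).2 hx) (h x)).symm
  have h12 : ρ₁ ≠ ρ₂ := fun h => hτne (RingHom.ext fun x => ψ.injective (DFunLike.congr_fun h x))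
  have h13 : ρ₁ ≠ ρ₃ := by
    intro h
    obtain ⟨y, hy⟩ := exists_mul_ne_conjugate_mul hβ
    apply hy
    rw [conjugate_apply, conjugate_apply, ← h1, ← h3, h]
  have h24 : ρ₂ ≠ ρ₄ := by
    intro h
    obtain ⟨y, hy⟩ := exists_mul_ne_conjugate_mul (α := α) (β := ComplexEmbedding.conjugate β)
      (fun h => hαβ (star_involutive.injective h).symm)
    apply hy
    rw [conjugate_apply β, conjugate_apply α, conjugate_apply (ComplexEmbedding.conjugate β),
      conjugate_conj, ← h2, ← h4, h]
  have h14 : ρ₁ ≠ ρ₄ := by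
    intro h
    exact hcancel α β fun y => by rw [conjugate_apply, ← h1, ← h4, h]
  have h23 : ρ₂ ≠ ρ₃ := by
    intro h
    exact hcancel α (ComplexEmbedding.conjugate β) fun y => by
      rw [conjugate_apply, conjugate_apply, ← h2, ← h3, h]
  have h34 : ρ₃ ≠ ρ₄ := fun h => h12 (hinv.injective h)
  have huniv : (Finset.univ : Finset (reflexField Φ →+* ℂ)) = {ρ₁, ρ₂, ρ₃, ρ₄} := by
    ext ρ
    simp only [Finset.mem_univ, Finset.mem_insert, Finset.mem_singleton, true_iff]
    -- Extended to `L`, an embedding of the reflex field sends a type norm to a product of two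
    -- embeddings of `K` that are neither equal nor conjugate. Of the sixteen pairs eight survive,
    -- and they give four products, each twice.
    obtain ⟨χ, hχ⟩ := exists_extension τ₁ ρ
    have hρ : ∀ y, ρ (typeNorm Φ y) = χ (algebraMap K L y) * χ (κ y) := fun y => by
      rw [← hχ, hτ₁z, map_mul]
    have hne1 : χ.comp κ ≠ χ.comp (algebraMap K L) := fun h =>
      hκi.elim fun x hx => hx (χ.injective (DFunLike.congr_fun h x))
    have hne2 : χ.comp κ ≠ ComplexEmbedding.conjugate (χ.comp (algebraMap K L)) := fun h =>
      hκc.elim fun x hx => hx (χ.injective (by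
        have := DFunLike.congr_fun h x
        rwa [conjugate_apply] at this))
    have hρ' : ∀ y, ρ (typeNorm Φ y) = χ.comp (algebraMap K L) y * χ.comp κ y := hρ
    rcases hall (χ.comp (algebraMap K L)) with h | h | h | h <;>
      rcases hall (χ.comp κ) with h' | h' | h' | h' <;>
      simp only [h, h'] at hρ' hne1 hne2
    all_goals first
      | exact absurd rfl hne1
      | exact absurd rfl hne2
      | exact absurd (star_involutive _).symm hne2
      | left
        apply reflexField_hom_ext
        intro y
        rw [hρ', h1]
        first | done | ring1 | (simp only [conjugate_apply]; ring1)
      | right; left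
        apply reflexField_hom_ext
        intro y
        rw [hρ', h2]
        first | done | ring1 | (simp only [conjugate_apply]; ring1) | (simp only [conjugate_apply]; done)
      | right; right; left
        apply reflexField_hom_ext
        intro y
        rw [hρ', h3]
        first | done | ring1 | (simp only [conjugate_apply]; ring1) | (simp only [conjugate_apply]; done)
      | right; right; right
        apply reflexField_hom_ext
        intro y
        rw [hρ', h4]
        first | done | ring1 | (simp only [conjugate_apply]; ring1) | (simp only [conjugate_apply]; done)
  -- In the product of the four values each of the four conjugates of `y` occurs twice.
  have hC : ((Algebra.norm ℚ (typeNorm Φ y) : ℚ) : ℂ) = (((Algebra.norm ℚ y) ^ 2 : ℚ) : ℂ) := by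
    rw [norm_eq_prod_ringHom, huniv, Finset.prod_insert (by simp [h12, h13, h14]),
      Finset.prod_insert (by simp [h23, h24]), Finset.prod_pair h34, h1, h2, h3, h4]
    push_cast
    rw [hnorm]
    ring
  exact_mod_cast hC

end ReflexNorm

/-! ### Principal ideals and ideals coprime to `f`. -/

section CoprimeIdeals

variable {R S A B : Type*} [CommRing R] [CommRing S] [CommRing A] [CommRing B] [Algebra R A]
  [Algebra S B]

theorem coe_principal (x : Aˣ) :
    (principal R x : Submodule R A) = Submodule.span R {(x : A)} := rfl

theorem extend_principal (ι : A →+* B)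
    (h : ∀ r : R, ∃ s : S, algebraMap S B s = ι (algebraMap R A r)) (x : Aˣ) :
    Units.map (extend ι h) (principal R x) = principal S (Units.map ι.toMonoidHom x) := by
  apply Units.ext
  change Submodule.span S (ι '' (Submodule.span R {(x : A)} : Set A)) = Submodule.span S {ι x}
  apply le_antisymm
  · rw [Submodule.span_le]
    rintro _ ⟨y, hy, rfl⟩
    obtain ⟨r, rfl⟩ := Submodule.mem_span_singleton.1 hy
    obtain ⟨s, hs⟩ := h r
    rw [Algebra.smul_def, map_mul, ← hs, ← Algebra.smul_def]
    exact Submodule.smul_mem _ _ (Submodule.mem_span_singleton_self _)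
  · rw [Submodule.span_le, Set.singleton_subset_iff]
    exact Submodule.subset_span ⟨x, Submodule.mem_span_singleton_self _, rfl⟩

theorem principal_mem_coprimeIdeals {f : ℕ} {x : Aˣ} {r : R} (hr : algebraMap R A r = x)
    (h : IsCoprime r (f : R)) : principal R x ∈ coprimeIdeals R A f := by
  refine Subgroup.subset_closure ⟨?_, ?_⟩
  · rw [coe_principal, Submodule.span_singleton_le_iff_mem]
    exact Submodule.mem_one.2 ⟨r, hr⟩
  · rw [coe_principal]
    apply le_antisymm
    · rw [sup_le_iff, Submodule.span_singleton_le_iff_mem, Submodule.span_singleton_le_iff_mem]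
      exact ⟨Submodule.mem_one.2 ⟨r, hr⟩, Submodule.mem_one.2 ⟨f, by simp⟩⟩
    · obtain ⟨a, b, hab⟩ := h
      rw [Submodule.one_le, Submodule.mem_sup]
      refine ⟨a • (x : A), Submodule.smul_mem _ _ (Submodule.mem_span_singleton_self _),
        b • (f : A), Submodule.smul_mem _ _ (Submodule.mem_span_singleton_self _), ?_⟩
      rw [← hr, Algebra.smul_def, Algebra.smul_def, ← map_natCast (algebraMap R A), ← map_mul,
        ← map_mul, ← map_add, hab, map_one]

theorem mul_sup_eq_one {I J F : Submodule R A} (hF : F ≤ 1) (hI : I ≤ 1) (hJ : J ≤ 1)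
    (hIF : I ⊔ F = 1) (hJF : J ⊔ F = 1) : I * J ⊔ F = 1 := by
  apply le_antisymm
  · exact sup_le (by simpa using mul_le_mul' hI hJ) hF
  · rw [← mul_one (1 : Submodule R A)]
    nth_rw 1 [← hIF]
    rw [← hJF, Submodule.sup_mul, Submodule.mul_sup, Submodule.mul_sup]
    refine sup_le (sup_le le_sup_left ?_) (sup_le ?_ ?_)
    · exact le_sup_of_le_right (by simpa using mul_le_mul' hI (le_refl F))
    · exact le_sup_of_le_right (by simpa using mul_le_mul' (le_refl F) hJ)
    · exact le_sup_of_le_right (by simpa using mul_le_mul' (le_refl F) hF)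

/-- A fractional ideal coprime to `f` is a quotient of integral ideals coprime to `f`. -/
theorem exists_mul_eq_of_mem_coprimeIdeals {f : ℕ} {I : (Submodule R A)ˣ}
    (hI : I ∈ coprimeIdeals R A f) :
    ∃ J J' : (Submodule R A)ˣ, (J : Submodule R A) ≤ 1 ∧ (J' : Submodule R A) ≤ 1 ∧
      (J : Submodule R A) ⊔ Submodule.span R {(f : A)} = 1 ∧
      (J' : Submodule R A) ⊔ Submodule.span R {(f : A)} = 1 ∧ I * J = J' := by
  have hF : Submodule.span R {(f : A)} ≤ 1 := by
    rw [Submodule.span_singleton_le_iff_mem]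
    exact Submodule.mem_one.2 ⟨f, by simp⟩
  have h1 : (1 : Submodule R A) ⊔ Submodule.span R {(f : A)} = 1 := sup_eq_left.2 hF
  induction hI using Subgroup.closure_induction with
  | mem I h => exact ⟨1, I, le_rfl, h.1, h1, h.2, mul_one I⟩
  | one => exact ⟨1, 1, le_rfl, le_rfl, h1, h1, mul_one 1⟩
  | mul I I' _ _ h h' =>
    obtain ⟨J, K, hJ, hK, hJf, hKf, h⟩ := h
    obtain ⟨J', K', hJ', hK', hJf', hKf', h'⟩ := h'
    refine ⟨J * J', K * K', ?_, ?_, mul_sup_eq_one hF hJ hJ' hJf hJf',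
      mul_sup_eq_one hF hK hK' hKf hKf', by rw [← h, ← h', mul_mul_mul_comm]⟩
    · simpa using mul_le_mul' hJ hJ'
    · simpa using mul_le_mul' hK hK'
  | inv I _ h =>
    obtain ⟨J, K, hJ, hK, hJf, hKf, h⟩ := h
    exact ⟨K, J, hK, hJ, hKf, hJf, by rw [← h, inv_mul_cancel_left]⟩

end CoprimeIdeals

/-! ### Orders as subrings of finite index. -/

section Order

variable {K : Type*} [Field K] [NumberField K] [IsCMField K] (O : CMOrder K)

local notation "conjK" => IsCMField.complexConj K

/-- An order as a subring of the ring of integers. -/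
def CMOrder.toSubring : Subring (𝓞 K) :=
  O.carrier.toSubring.comap (algebraMap (𝓞 K) K)

theorem CMOrder.isIntegral {x : K} (hx : x ∈ O.carrier) : IsIntegral ℤ x :=
  IsIntegral.of_mem_of_fg O.carrier O.fg x hx

theorem CMOrder.index_toSubring : O.toSubring.toAddSubgroup.index = O.index := by
  rw [CMOrder.index, ← AddSubgroup.relIndex_top_right]
  have h : (Subalgebra.toSubmodule (maximalOrder K).carrier).toAddSubgroup =
      (⊤ : AddSubgroup (𝓞 K)).map (algebraMap (𝓞 K) K).toAddMonoidHom := by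
    ext x
    constructor
    · exact fun hx => ⟨⟨x, hx⟩, trivial, rfl⟩
    · rintro ⟨y, -, rfl⟩
      exact y.2
  rw [h, ← AddSubgroup.relIndex_comap]
  rfl

theorem CMOrder.exists_zsmul_mem (x : K) : ∃ n : ℤ, n ≠ 0 ∧ n • x ∈ O.carrier := by
  have hx : x ∈ Submodule.span ℚ (O.carrier : Set K) := by rw [O.span_eq_top]; trivial
  induction hx using Submodule.span_induction with
  | mem x hx => exact ⟨1, one_ne_zero, by simpa using hx⟩
  | zero => exact ⟨1, one_ne_zero, by simp⟩
  | add x y _ _ h h' =>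
    obtain ⟨n, hn, h⟩ := h
    obtain ⟨m, hm, h'⟩ := h'
    refine ⟨n * m, mul_ne_zero hn hm, ?_⟩
    rw [smul_add, mul_comm, mul_smul, mul_comm, mul_smul]
    exact add_mem (O.carrier.smul_mem h _) (O.carrier.smul_mem h' _)
  | smul q x _ h =>
    obtain ⟨n, hn, h⟩ := h
    refine ⟨n * q.den, mul_ne_zero hn (by exact_mod_cast q.den_ne_zero), ?_⟩
    have : (n * (q.den : ℤ)) • q • x = q.num • n • x := by
      rw [zsmul_eq_mul, zsmul_eq_mul, zsmul_eq_mul, Algebra.smul_def, eq_ratCast]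
      have hq : (q.den : K) * (q : K) = q.num := by
        exact_mod_cast Rat.den_mul_eq_num q
      push_cast
      linear_combination (n : K) * x * hq
    rw [this]
    exact O.carrier.smul_mem h _

/-- The order spans `K` over `ℚ`, so the quotient is a finitely generated torsion group, hence
finite. -/
theorem CMOrder.index_toSubring_ne_zero : O.toSubring.toAddSubgroup.index ≠ 0 := by
  let N : Submodule ℤ (𝓞 K) := AddSubgroup.toIntSubmodule O.toSubring.toAddSubgroup
  have htors : Module.IsTorsion ℤ (𝓞 K ⧸ N) := by
    intro x
    obtain ⟨x, rfl⟩ := Submodule.Quotient.mk_surjective N x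
    obtain ⟨n, hn, h⟩ := O.exists_zsmul_mem (x : K)
    refine ⟨⟨n, mem_nonZeroDivisors_of_ne_zero hn⟩, ?_⟩
    change Submodule.Quotient.mk (p := N) (n • x) = 0
    rw [Submodule.Quotient.mk_eq_zero]
    change algebraMap (𝓞 K) K (n • x) ∈ O.carrier
    rwa [map_zsmul]
  have : Finite (𝓞 K ⧸ N) := Module.finite_of_fg_torsion _ htors
  have : Finite (𝓞 K ⧸ O.toSubring.toAddSubgroup) := this
  exact AddSubgroup.index_ne_zero_of_finite

theorem CMOrder.index_nsmul_mem {x : K} (hx : IsIntegral ℤ x) : O.index • x ∈ O.carrier := by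
  obtain ⟨x, rfl⟩ : ∃ y : 𝓞 K, algebraMap (𝓞 K) K y = x := ⟨⟨x, hx⟩, rfl⟩
  have h := AddSubgroup.nsmul_index_mem O.toSubring.toAddSubgroup x
  rw [O.index_toSubring] at h
  rw [← map_nsmul]
  exact h

/-- An integer of `K` generating an ideal of `O` that is coprime to the index lies in `O`. -/
theorem CMOrder.mem_of_principal_mem_coprimeIdeals {w : Kˣ} (hw : IsIntegral ℤ (w : K))
    (h : principal O.carrier w ∈ coprimeIdeals O.carrier K O.index) : (w : K) ∈ O.carrier := by
  obtain ⟨J, J', hJ, hJ', hJf, -, h⟩ := exists_mul_eq_of_mem_coprimeIdeals h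
  have hone : (1 : K) ∈ (J : Submodule O.carrier K) ⊔ Submodule.span O.carrier {(O.index : K)} := by
    rw [hJf]
    exact Submodule.one_le.1 le_rfl
  -- Write `1 = c + sf` with `c ∈ J` and `s` in the order. Then `wc` lies in the integral ideal
  -- `J'`, and `wsf` lies in `f𝓞 K`, which the order contains.
  obtain ⟨c, hc, d, hd, hcd⟩ := Submodule.mem_sup.1 hone
  obtain ⟨s, rfl⟩ := Submodule.mem_span_singleton.1 hd
  have hwc : (w : K) * c ∈ O.carrier := by
    have : (w : K) * c ∈ (1 : Submodule O.carrier K) := by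
      apply hJ'
      rw [← h]
      exact Submodule.mul_mem_mul (Submodule.mem_span_singleton_self _) hc
    obtain ⟨r, hr⟩ := Submodule.mem_one.1 this
    rw [← hr]
    exact r.2
  have hws := O.index_nsmul_mem (hw.mul (O.isIntegral s.2))
  have : (w : K) = w * c + O.index • (w * (s : K)) := by
    have hcd' : c + (s : K) * O.index = 1 := hcd
    rw [nsmul_eq_mul]
    linear_combination -(w : K) * hcd'
  rw [this]
  exact add_mem hwc hws

end Order

/-! ### Evaluating the maps on principal ideals. -/

section Main

variable {K : Type*} [Field K] [NumberField K] [IsCMField K]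

local notation "conjK" => IsCMField.complexConj K

theorem CMOrder.mem_ker_toClass (O : CMOrder K) {f : ℕ} {p : O.polarisedIdeals f} :
    p ∈ (O.toClass f).ker ↔ p ∈ O.principalPolarisedIdeals f := by
  rw [CMOrder.toClass, QuotientGroup.ker_mk']

theorem CMOrder.conjIdeal_principal (O : CMOrder K) (x : Kˣ) :
    O.conjIdeal (principal O.carrier x) =
      principal O.carrier (Units.map (conjK : K →* K) x) :=
  extend_principal _ _ x

theorem CMOrder.extendPair_fst {Kc : Type*} [Field Kc] [NumberField Kc] [Algebra K Kc]
    (O : CMOrder K) {f : ℕ} {p : O.polarisedIdeals f} {x : Kˣ}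
    (h : p.1.1 = principal O.carrier x) :
    O.extendPair Kc f p =
      (principal (𝓞 Kc) (Units.map (algebraMap K Kc).toMonoidHom x), p.1.2) := by
  refine Prod.ext ?_ rfl
  change Units.map _ p.1.1 = _
  rw [h]
  exact extend_principal _ _ x

theorem reflexTypeNorm_toPrincipalIdeal (Φ : Finset (K →+* ℂ)) (Kc : Type*) [Field Kc]
    [NumberField Kc] [Algebra K Kc] (z : (reflexField Φ)ˣ) :
    reflexTypeNorm Φ Kc (toPrincipalIdeal (𝓞 (reflexField Φ)) (reflexField Φ) z) =
      principal (𝓞 Kc) (∏ τ ∈ reflexType Φ Kc, Units.map τ.toMonoidHom z) := by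
  have h : Units.map (FractionalIdeal.coeSubmoduleHom (𝓞 (reflexField Φ))⁰
      (reflexField Φ)).toMonoidHom (toPrincipalIdeal (𝓞 (reflexField Φ)) (reflexField Φ) z) =
      principal (𝓞 (reflexField Φ)) z := by
    apply Units.ext
    change ((toPrincipalIdeal (𝓞 (reflexField Φ)) (reflexField Φ) z).1 :
      Submodule (𝓞 (reflexField Φ)) (reflexField Φ)) = _
    rw [coe_toPrincipalIdeal, FractionalIdeal.coe_spanSingleton]
    rfl
  rw [reflexTypeNorm, MonoidHom.finsetProd_apply, map_prod]
  refine Finset.prod_congr rfl fun τ _ => ?_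
  rw [MonoidHom.comp_apply, h]
  exact extend_principal _ _ z

end Main

/-! ### From the hypothesis on kernels to elements of the order. -/

section Main

variable {K : Type*} [Field K] [NumberField K] [IsCMField K]

local notation "conjK" => IsCMField.complexConj K
local notation "conjO" => IsCMField.ringOfIntegersComplexConj

theorem isIntegral_typeNorm (Φ : Finset (K →+* ℂ)) {y : K} (hy : IsIntegral ℤ y) :
    IsIntegral ℤ (typeNorm Φ y) := by
  rw [← isIntegral_algebraMap_iff (algebraMap (reflexField Φ) ℂ).injective]
  exact IsIntegral.prod _ fun φ _ => hy.map φ.toIntAlgHom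

/-- The principal ideal generated by the type norm of an integer coprime to `f`. -/
theorem toPrincipalIdeal_typeNorm_mem (Φ : Finset (K →+* ℂ)) {f : ℕ} {y : 𝓞 K}
    (hy : IsCoprime y (f : 𝓞 K)) {z : (reflexField Φ)ˣ} (hz : (z : reflexField Φ) = typeNorm Φ y)
    (hnorm : Algebra.norm ℚ (typeNorm Φ (y : K)) = (Algebra.norm ℚ (y : K)) ^ 2) :
    toPrincipalIdeal (𝓞 (reflexField Φ)) (reflexField Φ) z ∈ reflexIdeals Φ f := by
  let z' : 𝓞 (reflexField Φ) := ⟨typeNorm Φ y, isIntegral_typeNorm Φ y.2⟩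
  have hz' : algebraMap (𝓞 (reflexField Φ)) (reflexField Φ) z' = z := hz.symm
  have hn : Algebra.norm ℤ z' = (Algebra.norm ℤ y) ^ 2 := by
    have : ((Algebra.norm ℤ z' : ℤ) : ℚ) = (((Algebra.norm ℤ y) ^ 2 : ℤ) : ℚ) := by
      push_cast
      rw [Algebra.coe_norm_int, Algebra.coe_norm_int]
      exact hnorm
    exact_mod_cast this
  obtain ⟨q, -, hq⟩ := exists_mem_mul_eq_norm (⊤ : Subring (𝓞 (reflexField Φ)))
    (Subring.mem_top z')
  have hcop : IsCoprime z' (f : 𝓞 (reflexField Φ)) := by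
    -- Coprimality passes through norms: the norm of `z'` is the square of that of `y`, and `z'`
    -- divides its own norm.
    have h : IsCoprime ((Algebra.norm ℤ z' : ℤ)) (f : ℤ) := by
      rw [hn]
      exact (isCoprime_norm hy).pow_left
    have h' := h.map (Int.castRingHom (𝓞 (reflexField Φ)))
    simp only [eq_intCast, Int.cast_natCast] at h'
    rw [← hq] at h'
    exact h'.of_mul_left_left
  have h := principal_mem_coprimeIdeals hz' hcop
  change Units.map _ _ ∈ coprimeIdeals _ _ _
  convert h using 1
  apply Units.ext
  change ((toPrincipalIdeal (𝓞 (reflexField Φ)) (reflexField Φ) z).1 :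
    Submodule (𝓞 (reflexField Φ)) (reflexField Φ)) = _
  rw [coe_toPrincipalIdeal, FractionalIdeal.coe_spanSingleton]
  rfl

/-- The type norm of `y` generates an ideal whose image is the pair given by `t` and `t t̄`, so its
class for the maximal order is trivial. The inclusion of kernels provides a generator `w` over the
smaller order, and `w = ±t` because `w/t` is a unit of relative norm one. -/
theorem mem_of_S_le (hdeg : Module.finrank ℚ K = 4) (hbiq : ¬ IsBiquadratic K)
    (hζ : IsEmpty (K ≃+* CyclotomicField 5 ℚ))
    {Kc : Type*} [Field Kc] [NumberField Kc] [Algebra K Kc] [IsNormalClosure ℚ K Kc]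
    {Φ : Finset (K →+* ℂ)} (hΦ : IsCMType Φ) {O : CMOrder K}
    (hS : (maximalOrder K).S Φ Kc O.index ≤ O.S Φ Kc O.index) {y t : 𝓞 K} (hy0 : y ≠ 0)
    (hy : IsCoprime y (O.index : 𝓞 K)) (ht : t * conjO K y = (Algebra.norm ℤ y : 𝓞 K) * y) :
    (t : K) ∈ O.carrier := by
  obtain ⟨κ, hκn, hκt, hκz⟩ := exists_reflex_norms Kc hdeg hbiq hΦ
  set n : ℤ := Algebra.norm ℤ y with hn
  have hnq : (n : ℚ) = Algebra.norm ℚ (y : K) := Algebra.coe_norm_int y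
  have hyK : (y : K) ≠ 0 := RingOfIntegers.coe_ne_zero_iff.2 hy0
  have hyc : conjK (y : K) ≠ 0 := by simpa using hyK
  have hn0 : n ≠ 0 := by
    have : (n : ℚ) ≠ 0 := by rw [hnq]; exact Algebra.norm_ne_zero_iff.2 hyK
    exact_mod_cast this
  have htK : (t : K) * conjK (y : K) = n * y := by
    have := congrArg (algebraMap (𝓞 K) K) ht
    rwa [map_mul, map_mul, algebraMap_conj, map_intCast] at this
  have htc : conjK (t : K) * y = n * conjK (y : K) := by
    have := congrArg conjK htK
    rwa [map_mul, map_mul, map_intCast, IsCMField.complexConj_apply_apply] at this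
  have htt : (t : K) * conjK (t : K) = (n : K) ^ 2 := by
    apply mul_right_cancel₀ (mul_ne_zero hyK hyc)
    linear_combination conjK (t : K) * (y : K) * htK + n * y * htc
  have hnK : (n : K) ≠ 0 := by exact_mod_cast hn0
  have htK0 : (t : K) ≠ 0 := by
    intro h
    rw [h, zero_mul] at htt
    exact pow_ne_zero 2 hnK htt.symm
  let T : Kˣ := Units.mk0 t htK0
  let z : (reflexField Φ)ˣ := Units.map (typeNorm Φ) (Units.mk0 (y : K) hyK)
  have hz : (z : reflexField Φ) = typeNorm Φ y := rfl
  let N : (maximalRealSubfield K)ˣ := Units.mk0 ((n : maximalRealSubfield K) ^ 2)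
    (pow_ne_zero 2 (by exact_mod_cast hn0))
  have hNK : ((N : maximalRealSubfield K) : K) = (n : K) ^ 2 := by
    change algebraMap (maximalRealSubfield K) K ((n : maximalRealSubfield K) ^ 2) = _
    rw [map_pow, map_intCast]
  have hTcop : principal (maximalOrder K).carrier T ∈
      coprimeIdeals (maximalOrder K).carrier K O.index := by
    have h : IsCoprime t (O.index : 𝓞 K) := by
      have h' := ((isCoprime_norm hy).pow_left (m := 2)).map (Int.castRingHom (𝓞 K))
      simp only [eq_intCast, Int.cast_natCast, Int.cast_pow, ← hn] at h'
      have : (n : 𝓞 K) ^ 2 = t * conjO K t := by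
        apply RingOfIntegers.ext
        change algebraMap (𝓞 K) K _ = (t : K) * conjK (t : K)
        rw [htt, map_pow, map_intCast]
      rw [this] at h'
      exact h'.of_mul_left_left
    exact principal_mem_coprimeIdeals (R := (maximalOrder K).carrier) (A := K)
      (r := (t : (maximalOrder K).carrier)) rfl h
  let p : (maximalOrder K).polarisedIdeals O.index := ⟨(principal _ T, N), hTcop, by
    rw [CMOrder.conjIdeal_principal, ← map_mul]
    congr 1
    apply Units.ext
    exact htt.trans hNK.symm, fun φ => by
      change 0 < φ ((n : maximalRealSubfield K) ^ 2)
      rw [map_pow, map_intCast]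
      have : (n : ℝ) ≠ 0 := by exact_mod_cast hn0
      positivity⟩
  have hp : p ∈ ((maximalOrder K).toClass O.index).ker :=
    (CMOrder.mem_ker_toClass _).2 ⟨T, rfl, hNK.trans htt.symm⟩
  let b : reflexIdeals Φ O.index := ⟨toPrincipalIdeal _ _ z,
    toPrincipalIdeal_typeNorm_mem Φ hy hz (hκz _)⟩
  have hpair : reflexPair Φ Kc O.index b =
      (principal (𝓞 Kc) (Units.map (algebraMap K Kc).toMonoidHom T), N) := by
    refine Prod.ext ?_ ?_
    · change reflexTypeNorm Φ Kc (toPrincipalIdeal _ _ z) = _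
      rw [reflexTypeNorm_toPrincipalIdeal]
      congr 1
      apply Units.ext
      rw [Units.coe_prod]
      change ∏ τ ∈ reflexType Φ Kc, τ (typeNorm Φ y) = algebraMap K Kc t
      rw [hκt]
      have hL := congrArg (algebraMap K Kc) htK
      have hnL : (n : Kc) = ((Algebra.norm ℚ (y : K) : ℚ) : Kc) := by
        rw [← hnq, Rat.cast_intCast]
      rw [map_mul, map_mul, map_intCast, hnL, hκn] at hL
      have hyL : algebraMap K Kc (conjK (y : K)) ≠ 0 := by simpa using hyK
      apply mul_right_cancel₀ hyL
      -- After multiplication by `ȳ` both sides equal `N(y)y`, by the factorisation of `N(y)` into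
      -- its four conjugates.
      linear_combination -hL
    · apply Units.ext
      change algebraMap ℚ (maximalRealSubfield K) (FractionalIdeal.absNorm
        (toPrincipalIdeal (𝓞 (reflexField Φ)) (reflexField Φ) z).1) = (n : maximalRealSubfield K) ^ 2
      rw [coe_toPrincipalIdeal, FractionalIdeal.absNorm_span_singleton, hz, hκz, ← hnq,
        abs_of_nonneg (sq_nonneg _), map_pow, map_intCast]
  have hb : b ∈ (maximalOrder K).S Φ Kc O.index := by
    refine ⟨p, hp, ?_⟩
    rw [hpair]
    exact CMOrder.extendPair_fst _ rfl
  obtain ⟨p', hp', hpb⟩ := hS hb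
  obtain ⟨w, hw1, hw2⟩ := (CMOrder.mem_ker_toClass _).1 hp'
  rw [hpair, CMOrder.extendPair_fst _ hw1, Prod.mk.injEq] at hpb
  obtain ⟨hwt, hwN⟩ := hpb
  rw [hwN, hNK, ← htt] at hw2
  have hwmem : algebraMap K Kc w ∈ Submodule.span (𝓞 Kc) {algebraMap K Kc t} := by
    have h : Submodule.span (𝓞 Kc) {algebraMap K Kc w} =
        Submodule.span (𝓞 Kc) {algebraMap K Kc t} := congrArg Units.val hwt
    rw [← h]
    exact Submodule.mem_span_singleton_self _
  -- The ideals of `w` and `t` are only compared after extension to `Kc`, but this already makes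
  -- `w/t` integral.
  obtain ⟨u, hu⟩ := Submodule.mem_span_singleton.1 hwmem
  have hζint : IsIntegral ℤ ((w : K) / t) := by
    rw [← isIntegral_algebraMap_iff (algebraMap K Kc).injective, map_div₀, ← hu,
      Algebra.smul_def, mul_div_cancel_right₀ _ ((map_ne_zero _).2 htK0)]
    exact u.2
  have hζ1 : (w : K) / t * conjK ((w : K) / t) = 1 := by
    rw [map_div₀, div_mul_div_comm, ← hw2, div_self (htt ▸ pow_ne_zero 2 hnK)]
  have hwO : IsIntegral ℤ (w : K) → (w : K) ∈ O.carrier := fun h =>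
    O.mem_of_principal_mem_coprimeIdeals h (hw1 ▸ p'.2.1)
  rcases eq_one_or_neg_one_of_mul_conj_eq_one hdeg hbiq hζ hζint hζ1 with h | h
  · have hwt' : (w : K) = t := by rw [div_eq_iff htK0] at h; simpa using h
    rw [← hwt']
    exact hwO (hwt' ▸ t.2)
  · have hwt' : (w : K) = -t := by rw [div_eq_iff htK0] at h; simpa using h
    have := hwO (hwt' ▸ IsIntegral.neg t.2)
    rw [hwt'] at this
    simpa using O.carrier.neg_mem this

end Main

end CMIndex

end

theorem theorem1 {K : Type*} [Field K] [NumberField K] [IsCMField K]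
    (hdeg : Module.finrank ℚ K = 4) (hbiq : ¬ CMIndex.IsBiquadratic K)
    (hζ : IsEmpty (K ≃+* CyclotomicField 5 ℚ))
    (Kc : Type*) [Field Kc] [NumberField Kc] [Algebra K Kc] [IsNormalClosure ℚ K Kc]
    (Φ : Finset (K →+* ℂ)) (hΦ : CMIndex.IsCMType Φ)
    (O' : CMIndex.CMOrder K)
    (hS : (CMIndex.maximalOrder K).S Φ Kc O'.index ≤ O'.S Φ Kc O'.index) :
    O'.index ^ 2 ∣ 2 ^ 40 * 3 ^ 16 *
      Ideal.absNorm (CMIndex.relDiscr (maximalRealSubfield K) K) := by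
  rw [← O'.index_toSubring]
  refine CMIndex.index_sq_dvd_of_norm_mul_div_conj_mem hdeg O'.index_toSubring_ne_zero
    fun y t hy ht => ?_
  have hy' := hy
  rw [O'.index_toSubring] at hy'
  -- Zero is coprime to the index only when the index is `1`, and then the order is maximal.
  by_cases hy0 : y = 0
  · have h := CMIndex.isCoprime_norm hy
    rw [hy0, Algebra.norm_zero, isCoprime_zero_left, Int.isUnit_iff_natAbs_eq, Int.natAbs_natCast] at h
    have htop := AddSubgroup.index_eq_one.1 h
    change t ∈ O'.toSubring.toAddSubgroup
    rw [htop]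
    trivial
  · exact CMIndex.mem_of_S_le hdeg hbiq hζ hΦ hS hy0 hy' ht
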